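/- Let $G$ be a Hausdorff, locally compact, second countable, unimodular topological group with Haar measure $\mu$, let $Z$ be its centre, let $\alpha$ be a Haar measure on $X=G/Z$, and let $s:X\to G$ be a Borel section of the canonical projection $G\to X$. Let $\pi$ be a strongly continuous irreducible unitary representation of $G$ on a complex separable Hilbert space $\mathcal H$ which is square integrable modulo the centre, i.e. $x\mapsto\langle \pi(s(x))u,v\rangle$ belongs to $L^2(X,\alpha)$ for all $u,v\in\mathcal H$. A state is a positive trace class operator on $\mathcal H$ of trace one. For a state $T$ and a Borel set $E\subset X$ put $$Q_T(E)=\int_E \pi(s(x))\,T\,\pi(s(x))^{-1}\,d\alpha(x)\qquad\text{(weak integral)}.$$ (If $\alpha$ is normalized so that $Q_T(X)=I$, this is a normalized covariant positive operator measure; the result does not depend on the normalization.) Let $G_1$ be the commutator subgroup of $G$, i.e. the subgroup generated by the elements $ghg^{-1}h^{-1}$, $g,h\in G$. Suppose that there are a linear subspace $\mathcal K$ of $\mathcal H$ and a character $c:G_1\to\mathbb T$ (a homomorphism to the complex numbers of modulus one) such that $\pi(g)v=c(g)v$ for all $g\in G_1$ and $v\in\mathcal K$. Let $T$ be a state with $T\mathcal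 H\subset\mathcal K$ and $\operatorname{tr}[T\pi(g)]\neq 0$ for $\mu$-almost all $g\in G$. Then $Q_T(E)$ exists as a bounded operator for every Borel set $E\subset X$, and $Q_T$ is informationally complete: if $W_1,W_2$ are states with $\operatorname{tr}[W_1Q_T(E)]=\operatorname{tr}[W_2Q_T(E)]$ for all Borel sets $E\subset X$, then $W_1=W_2$. -/

import Mathlib

open MeasureTheory

namespace SquareIntegrable

/-- The quotient `σ`-algebra on `G ⧸ Z`, which is the one Mathlib puts there, is the Borel `σ`-algebra
of the quotient topology. -/
theorem borelSpace_quotient_center (G : Type*) [Group G] [TopologicalSpace G] [IsTopologicalGroup G]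
    [T2Space G] [LocallyCompactSpace G] [SecondCountableTopology G] [MeasurableSpace G]
    [BorelSpace G] : BorelSpace (G ⧸ Subgroup.center G) := by
  have hZ : IsClosed ((Subgroup.center G : Subgroup G) : Set G) := by
    have h := Set.isClosed_centralizer (Set.univ : Set G)
    rwa [Set.centralizer_univ] at h
  let := IsTopologicalGroup.rightUniformSpace G
  have : IsRightUniformGroup G := { uniformity_eq := rfl }
  have : CompleteSpace G := IsRightUniformGroup.completeSpace_of_weaklyLocallyCompactSpace
  have : (uniformity G).IsCountablyGenerated := by
    rw [uniformity_eq_comap_mul_inv_nhds_one]; infer_instance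
  have : PolishSpace G := ⟨⟩
  infer_instance

noncomputable section

/-- The index set of a fixed orthonormal (Hilbert) basis of `H`. -/
def basisSet (H : Type*) [NormedAddCommGroup H] [InnerProductSpace ℂ H] [CompleteSpace H] :
    Set H :=
  (exists_hilbertBasis ℂ H).choose

/-- A fixed orthonormal (Hilbert) basis of `H`. -/
def basis (H : Type*) [NormedAddCommGroup H] [InnerProductSpace ℂ H] [CompleteSpace H] :
    HilbertBasis (basisSet H) ℂ H :=
  (exists_hilbertBasis ℂ H).choose_spec.choose

section Hilbert

variable {H : Type*} [NormedAddCommGroup H] [InnerProductSpace ℂ H] [CompleteSpace H]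

/-- The trace `∑ i, ⟪e i, A (e i)⟫` of a trace class operator `A`, computed in an orthonormal basis
(for trace class `A` the series converges absolutely, and its sum is the same in all bases). -/
def trace (A : H →L[ℂ] H) : ℂ :=
  ∑' i : basisSet H, inner ℂ (basis H i) (A (basis H i))

/-- A state: a positive trace class operator of trace one. For a positive operator, being trace
class means that the series of its diagonal matrix elements converges. -/
structure IsState (T : H →L[ℂ] H) : Prop where
  isPositive : T.IsPositive
  hasSum_one : HasSum (fun i : basisSet H => inner ℂ (basis H i) (T (basis H i))) 1

/-- An operator valued set function `Q` on the measurable sets of `X` is informationally complete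
if its values separate the states. -/
def InformationallyComplete {X : Type*} [MeasurableSpace X] (Q : Set X → H →L[ℂ] H) : Prop :=
  ∀ W₁ W₂ : H →L[ℂ] H, IsState W₁ → IsState W₂ →
    (∀ E : Set X, MeasurableSet E → trace (W₁ ∘L Q E) = trace (W₂ ∘L Q E)) → W₁ = W₂

variable {G : Type*} [Group G]

/-- Topological irreducibility of a unitary representation on a Hilbert space: the space is nonzero
and its only closed invariant subspaces are the trivial ones. -/
def IsIrreducible (π : G →* unitary (H →L[ℂ] H)) : Prop :=
  Nontrivial H ∧ ∀ V : Submodule ℂ H, IsClosed (V : Set H) →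
    (∀ g : G, ∀ v ∈ V, (π g : H →L[ℂ] H) v ∈ V) → V = ⊥ ∨ V = ⊤

variable [MeasurableSpace (G ⧸ Subgroup.center G)]

/-- Square integrability modulo the centre: every coefficient `g ↦ ⟪π g u, v⟫`, composed with the
section `s` of `G → G ⧸ Z`, is in `L²(G ⧸ Z, α)`. -/
def IsSquareIntegrableModCenter (π : G →* unitary (H →L[ℂ] H))
    (s : G ⧸ Subgroup.center G → G) (α : Measure (G ⧸ Subgroup.center G)) : Prop :=
  ∀ u v : H, MemLp (fun x => inner ℂ ((π (s x) : H →L[ℂ] H) u) v) 2 α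

/-- `A` is the weak integral over `E` of the operators `π (s x) T (π (s x))⁻¹`. -/
def IsWeakIntegral (π : G →* unitary (H →L[ℂ] H)) (s : G ⧸ Subgroup.center G → G)
    (α : Measure (G ⧸ Subgroup.center G)) (T : H →L[ℂ] H) (E : Set (G ⧸ Subgroup.center G))
    (A : H →L[ℂ] H) : Prop :=
  ∀ u v : H,
    IntegrableOn
      (fun x => inner ℂ u ((π (s x) : H →L[ℂ] H) (T ((π ((s x)⁻¹) : H →L[ℂ] H) v)))) E α ∧
    inner ℂ u (A v) =
      ∫ x in E, inner ℂ u ((π (s x) : H →L[ℂ] H) (T ((π ((s x)⁻¹) : H →L[ℂ] H) v))) ∂α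

open Classical in
/-- The covariant positive operator measure `Q_T(E) = ∫_E π (s x) T (π (s x))⁻¹ dα(x)` (weak
integral), with the normalization given by the Haar measure `α`. The
value `0` is a default that is only used if there is no weak integral. -/
def covariantPOM (π : G →* unitary (H →L[ℂ] H)) (s : G ⧸ Subgroup.center G → G)
    (α : Measure (G ⧸ Subgroup.center G)) (T : H →L[ℂ] H) (E : Set (G ⧸ Subgroup.center G)) :
    H →L[ℂ] H :=
  if h : ∃ A : H →L[ℂ] H, IsWeakIntegral π s α T E A then h.choose else 0

end Hilbert

end

end SquareIntegrable

namespace SquareIntegrable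

open scoped InnerProductSpace ComplexConjugate commutatorElement BoundedContinuousFunction

/-! ### Unitary representations, Schur's lemma, countability of the basis -/

section Hilbert

variable {H : Type*} [NormedAddCommGroup H] [InnerProductSpace ℂ H] [CompleteSpace H]
  {G : Type*} [Group G]

/-! Two functions on `G` carry the proof: tr[W π(g)] (`coeffTrace`) and tr[W π(g) T π(g)⁻¹]
(`conjTrace`). Read on the section, the second is the density of E ↦ tr[W Q_T(E)]. States with equal
statistics therefore have densities equal almost everywhere, and everywhere by continuity. The
orthogonality relations, extended to trace class operators, give d · tr[W π(g) T π(g)⁻¹] = ∫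
conj(tr[W π(x)]) tr[T π(g⁻¹xg)] dα(x) (`HasOrthogonality.integral_coeffTrace_conj`).

The hypotheses on T turn the right side into a Fourier transform. Since tr[T π(g)] ≠ 0 almost
everywhere, c is invariant under conjugation by G. The vectors on which G₁ acts through c then form
a closed invariant subspace, nonzero and hence equal to H (`IsIrreducible.commutator_apply`). So
π(gxg⁻¹) = χ_g(x) π(x), where χ_g(x) = c([g,x]) is a continuous bicharacter, and the densities are
the Fourier coefficients of conj(tr[W π]) tr[T π] along the χ_g.

This transform is injective (`comp_section_ae_eq_zero`). Countably many χ_g map G to the compact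
space 𝕋^ℕ. By Schur's lemma the function to be recovered is constant on the fibres of this map, and
trigonometric polynomials on 𝕋^ℕ separate finite measures. Dividing by tr[T π], which is nonzero
almost everywhere, gives tr[W₁ π] = tr[W₂ π]. Orthogonality against rank one operators then yields
W₁ = W₂. -/

theorem unitary_inner_map_map (U : unitary (H →L[ℂ] H)) (u v : H) :
    inner ℂ ((U : H →L[ℂ] H) u) ((U : H →L[ℂ] H) v) = inner ℂ u v := by
  rw [← ContinuousLinearMap.adjoint_inner_right, ← ContinuousLinearMap.star_eq_adjoint,
    ← mul_apply_eq_comp, Unitary.coe_star_mul_self]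
  rfl

theorem rep_mul_apply (π : G →* unitary (H →L[ℂ] H)) (g h : G) (v : H) :
    (π (g * h) : H →L[ℂ] H) v = (π g : H →L[ℂ] H) ((π h : H →L[ℂ] H) v) := by
  rw [map_mul]; rfl

theorem rep_one_apply (π : G →* unitary (H →L[ℂ] H)) (v : H) :
    (π 1 : H →L[ℂ] H) v = v := by
  rw [map_one]; rfl

theorem rep_inv_apply_self (π : G →* unitary (H →L[ℂ] H)) (g : G) (v : H) :
    (π g⁻¹ : H →L[ℂ] H) ((π g : H →L[ℂ] H) v) = v := by
  rw [← rep_mul_apply, inv_mul_cancel, rep_one_apply]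

theorem rep_self_apply_inv (π : G →* unitary (H →L[ℂ] H)) (g : G) (v : H) :
    (π g : H →L[ℂ] H) ((π g⁻¹ : H →L[ℂ] H) v) = v := by
  rw [← rep_mul_apply, mul_inv_cancel, rep_one_apply]

theorem rep_inner_left (π : G →* unitary (H →L[ℂ] H)) (g : G) (u v : H) :
    inner ℂ ((π g : H →L[ℂ] H) u) v = inner ℂ u ((π g⁻¹ : H →L[ℂ] H) v) := by
  rw [← unitary_inner_map_map (π g⁻¹), rep_inv_apply_self]

theorem rep_norm_apply (π : G →* unitary (H →L[ℂ] H)) (g : G) (v : H) :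
    ‖(π g : H →L[ℂ] H) v‖ = ‖v‖ := by
  have h := unitary_inner_map_map (π g) v v
  rw [inner_self_eq_norm_sq_to_K, inner_self_eq_norm_sq_to_K] at h
  have h2 : ‖(π g : H →L[ℂ] H) v‖ ^ 2 = ‖v‖ ^ 2 := by exact_mod_cast h
  exact (sq_eq_sq₀ (norm_nonneg _) (norm_nonneg _)).1 h2

theorem rep_inner_eq (π : G →* unitary (H →L[ℂ] H)) (g : G) (u v t : H) :
    inner ℂ ((π g⁻¹ : H →L[ℂ] H) u) t * inner ℂ t ((π g⁻¹ : H →L[ℂ] H) v) =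
      inner ℂ ((π g : H →L[ℂ] H) t) v * conj (inner ℂ ((π g : H →L[ℂ] H) t) u) := by
  rw [rep_inner_left π g, rep_inner_left π g, inner_conj_symm, mul_comm]

theorem star_rep (π : G →* unitary (H →L[ℂ] H)) (g : G) :
    star (π g : H →L[ℂ] H) = (π g⁻¹ : H →L[ℂ] H) := by
  rw [map_inv]; rfl

/-- Schur's lemma for self-adjoint operators. -/
theorem IsIrreducible.exists_eq_smul_of_isSelfAdjoint {π : G →* unitary (H →L[ℂ] H)}
    (hirr : IsIrreducible π) {A : H →L[ℂ] H} (hA : IsSelfAdjoint A)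
    (hcomm : ∀ g, Commute A (π g : H →L[ℂ] H)) : ∃ a : ℂ, A = a • (1 : H →L[ℂ] H) := by
  have := hirr.1
  -- Two spectral points a < b would give nonzero f(A) and g(A), with f and g supported on either
  -- side of the midpoint, so f(A)g(A) = 0. The kernel of f(A) is closed and invariant. It contains
  -- the range of g(A), so it is not zero, and it is not all of H.
  have key : ∀ a ∈ spectrum ℝ A, ∀ b ∈ spectrum ℝ A, ¬ a < b := by
    intro a ha b hb hab
    let m := (a + b) / 2
    let f : ℝ → ℝ := fun x => max 0 (x - m)
    let g : ℝ → ℝ := fun x => max 0 (m - x)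
    have hf : Continuous f := by fun_prop
    have hg : Continuous g := by fun_prop
    have hfg : cfc f A * cfc g A = 0 := by
      rw [← cfc_mul f g A hf.continuousOn hg.continuousOn]
      have : (fun x => f x * g x) = fun _ => (0 : ℝ) := by
        funext x
        rcases le_total x m with h | h
        · have : f x = 0 := max_eq_left (by linarith)
          rw [this, zero_mul]
        · have : g x = 0 := max_eq_left (by linarith)
          rw [this, mul_zero]
      rw [this]
      exact cfc_const_zero ℝ A
    have hne : ∀ (k : ℝ → ℝ), Continuous k → ∀ x ∈ spectrum ℝ A, k x ≠ 0 → cfc k A ≠ 0 := by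
      intro k hk x hx hkx h0
      have h1 : k x ∈ spectrum ℝ (cfc k A) := by
        rw [cfc_map_spectrum k A hA hk.continuousOn]
        exact ⟨x, hx, rfl⟩
      rw [h0, spectrum.zero_eq] at h1
      exact hkx h1
    have hfne : cfc f A ≠ 0 := by
      refine hne f hf b hb (ne_of_gt (lt_max_of_lt_right ?_))
      simp only [m]; linarith
    have hgne : cfc g A ≠ 0 := by
      refine hne g hg a ha (ne_of_gt (lt_max_of_lt_right ?_))
      simp only [m]; linarith
    have hcf : ∀ x, Commute (cfc f A) (π x : H →L[ℂ] H) := fun x =>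
      Commute.cfc (hcomm x) (by rw [hA.star_eq]; exact hcomm x) f
    have hinv : ∀ x, ∀ v ∈ LinearMap.ker ((cfc f A : H →L[ℂ] H) : H →ₗ[ℂ] H),
        (π x : H →L[ℂ] H) v ∈ LinearMap.ker ((cfc f A : H →L[ℂ] H) : H →ₗ[ℂ] H) := by
      intro x v hv
      have h1 : (cfc f A) v = 0 := by simpa using hv
      have := congrArg (fun B : H →L[ℂ] H => B v) (hcf x).eq
      simp only [mul_apply_eq_comp, h1, map_zero] at this
      simpa using this
    rcases hirr.2 _ (ContinuousLinearMap.isClosed_ker (cfc f A : H →L[ℂ] H)) hinv with h | h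
    · apply hgne
      ext v
      have : (cfc g A) v ∈ LinearMap.ker ((cfc f A : H →L[ℂ] H) : H →ₗ[ℂ] H) := by
        have := congrArg (fun B : H →L[ℂ] H => B v) hfg
        simpa using this
      rw [h] at this
      simpa using this
    · apply hfne
      ext v
      have : v ∈ LinearMap.ker ((cfc f A : H →L[ℂ] H) : H →ₗ[ℂ] H) := by rw [h]; trivial
      simpa using this
  obtain ⟨a, ha⟩ : (spectrum ℝ A).Nonempty :=
    ContinuousFunctionalCalculus.spectrum_nonempty A hA
  refine ⟨(a : ℂ), ?_⟩
  have h1 : cfc (id : ℝ → ℝ) A = cfc (fun _ => a) A := by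
    apply cfc_congr
    intro x hx
    exact le_antisymm (not_lt.1 (key a ha x hx)) (not_lt.1 (key x hx a ha))
  rw [cfc_id ℝ A, cfc_const a A] at h1
  rw [h1, Algebra.algebraMap_eq_smul_one]
  ext v
  simp

/-- Schur's lemma. -/
theorem IsIrreducible.exists_eq_smul {π : G →* unitary (H →L[ℂ] H)}
    (hirr : IsIrreducible π) {A : H →L[ℂ] H}
    (hcomm : ∀ g, Commute A (π g : H →L[ℂ] H)) : ∃ a : ℂ, A = a • (1 : H →L[ℂ] H) := by
  have hstar : ∀ g, Commute (star A) (π g : H →L[ℂ] H) := by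
    intro g
    have h := (hcomm g⁻¹).star_star
    rwa [star_rep, inv_inv] at h
  obtain ⟨a, ha⟩ := hirr.exists_eq_smul_of_isSelfAdjoint (realPart A).2 (fun g => by
    rw [realPart_apply_coe]
    exact ((hcomm g).add_left (hstar g)).smul_left _)
  obtain ⟨b, hb⟩ := hirr.exists_eq_smul_of_isSelfAdjoint (imaginaryPart A).2 (fun g => by
    rw [imaginaryPart_apply_coe]
    exact (((hcomm g).sub_left (hstar g)).smul_left _).smul_left _)
  refine ⟨a + Complex.I * b, ?_⟩
  rw [← realPart_add_I_smul_imaginaryPart A, ha, hb, smul_smul, ← add_smul]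

/-- Distinct basis vectors are at distance √2, so the balls of radius 1/2 around them are disjoint.
Countability is what allows series to be integrated term by term later. -/
theorem basisSet_countable [TopologicalSpace.SeparableSpace H] : Countable (basisSet H) := by
  have ho := (basis H).orthonormal
  have hd : Pairwise (fun i j : basisSet H =>
      Disjoint (Metric.ball (basis H i) (1 / 2)) (Metric.ball (basis H j) (1 / 2))) := by
    intro i j hij
    apply Metric.ball_disjoint_ball
    have h2 : ‖basis H i - basis H j‖ ^ 2 = 2 := by
      rw [@norm_sub_sq ℂ, ho.2 hij, ho.1 i, ho.1 j]; norm_num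
    rw [dist_eq_norm]
    nlinarith [norm_nonneg (basis H i - basis H j)]
  exact Pairwise.countable_of_isOpen_disjoint hd (fun _ => Metric.isOpen_ball)
    (fun i => ⟨basis H i, Metric.mem_ball_self (by norm_num)⟩)

theorem hasSum_norm_inner_basis_sq (v : H) :
    HasSum (fun i : basisSet H => ‖inner ℂ (basis H i) v‖ ^ 2) (‖v‖ ^ 2) := by
  have h := (basis H).hasSum_inner_mul_inner v v
  rw [inner_self_eq_norm_sq_to_K] at h
  have h2 : (fun i : basisSet H => inner ℂ v (basis H i) * inner ℂ (basis H i) v) =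
      fun i => ((‖inner ℂ (basis H i) v‖ ^ 2 : ℝ) : ℂ) := by
    funext i
    rw [← inner_conj_symm v, RCLike.conj_mul]
    push_cast
    rfl
  rw [h2] at h
  exact Complex.hasSum_ofReal.1 (by rw [Complex.ofReal_pow]; exact h)

end Hilbert

/-! ### Positive trace class operators as sums of rank one operators -/

section Hilbert

variable {H : Type*} [NormedAddCommGroup H] [InnerProductSpace ℂ H] [CompleteSpace H]
  {G : Type*} [Group G] {ι κ : Type*}

theorem basisSet_summable_prod {t : ι → H} (ht : Summable fun i => ‖t i‖ ^ 2) :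
    Summable fun p : ι × basisSet H => ‖inner ℂ (basis H p.2) (t p.1)‖ ^ 2 := by
  rw [summable_prod_of_nonneg (fun _ => by positivity)]
  refine ⟨fun i => (hasSum_norm_inner_basis_sq (t i)).summable, ?_⟩
  simpa only [(hasSum_norm_inner_basis_sq _).tsum_eq] using ht

/-- The operator `T` is the sum of the rank one operators `v ↦ ⟪t i, v⟫ t i`, with trace class
norm convergence. -/
structure IsRankOneSum (T : H →L[ℂ] H) (t : ι → H) : Prop where
  summable : Summable fun i => ‖t i‖ ^ 2
  hasSum : ∀ u v : H, HasSum (fun i => inner ℂ u (t i) * inner ℂ (t i) v) (inner ℂ u (T v))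

/-- The trace of `T ∘ B` for a bounded operator `B`. -/
theorem IsRankOneSum.trace_comp {T : H →L[ℂ] H} {t : ι → H} (h : IsRankOneSum T t)
    (B : H →L[ℂ] H) : trace (T ∘L B) = ∑' i, inner ℂ (t i) (B (t i)) := by
  let F : basisSet H → ι → ℂ := fun j i =>
    inner ℂ (basis H j) (t i) * inner ℂ (t i) (B (basis H j))
  have hF : ∀ j i, F j i = inner ℂ (ContinuousLinearMap.adjoint B (t i)) (basis H j) *
      inner ℂ (basis H j) (t i) := by
    intro j i
    rw [ContinuousLinearMap.adjoint_inner_left, mul_comm]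
  have hB : Summable fun i => ‖ContinuousLinearMap.adjoint B (t i)‖ ^ 2 := by
    refine Summable.of_nonneg_of_le (fun _ => by positivity) (fun i => ?_)
      (h.summable.mul_left (‖ContinuousLinearMap.adjoint B‖ ^ 2))
    rw [← mul_pow]
    gcongr
    exact ContinuousLinearMap.le_opNorm _ _
  -- Absolute convergence, needed to exchange the sums: with B moved to the other side as its
  -- adjoint, each term is a product of two square summable families.
  have hs : Summable (Function.uncurry fun i j => F j i) := by
    refine Summable.of_norm_bounded
      ((basisSet_summable_prod hB).add (basisSet_summable_prod h.summable)) ?_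
    rintro ⟨i, j⟩
    simp only [Function.uncurry]
    rw [hF, norm_mul, norm_inner_symm]
    nlinarith [sq_nonneg (‖inner ℂ (basis H j) (ContinuousLinearMap.adjoint B (t i))‖ -
      ‖inner ℂ (basis H j) (t i)‖), sq_nonneg
      (‖inner ℂ (basis H j) (ContinuousLinearMap.adjoint B (t i))‖ +
      ‖inner ℂ (basis H j) (t i)‖)]
  calc trace (T ∘L B) = ∑' j, ∑' i, F j i := by
        unfold trace
        congr 1
        funext j
        exact ((h.hasSum (basis H j) (B (basis H j))).tsum_eq).symm
    _ = ∑' i, ∑' j, F j i := hs.tsum_comm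
    _ = ∑' i, inner ℂ (t i) (B (t i)) := by
        congr 1
        funext i
        simp_rw [hF]
        rw [((basis H).hasSum_inner_mul_inner _ _).tsum_eq, ContinuousLinearMap.adjoint_inner_left]

/-- The matrix elements of `π g T (π g)⁻¹`. -/
theorem IsRankOneSum.hasSum_rep {T : H →L[ℂ] H} {t : ι → H} (hT : IsRankOneSum T t)
    (π : G →* unitary (H →L[ℂ] H)) (g : G) (u v : H) :
    HasSum (fun i => inner ℂ ((π g : H →L[ℂ] H) (t i)) v *
        conj (inner ℂ ((π g : H →L[ℂ] H) (t i)) u))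
      (inner ℂ u ((π g : H →L[ℂ] H) (T ((π g⁻¹ : H →L[ℂ] H) v)))) := by
  have h1 := hT.hasSum ((π g⁻¹ : H →L[ℂ] H) u) ((π g⁻¹ : H →L[ℂ] H) v)
  simp only [rep_inner_eq] at h1
  rwa [rep_inner_left, inv_inv] at h1

/-- The vectors are t i = √T (e i). The last clause passes relations valid on the range of T to the
t i, since (B√T)(B√T)* = B T B*. -/
theorem IsState.exists_isRankOneSum {T : H →L[ℂ] H} (hT : IsState T) :
    ∃ t : basisSet H → H, IsRankOneSum T t ∧ ∀ B : H →L[ℂ] H, B ∘L T = 0 → ∀ i, B (t i) = 0 := by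
  have hpos : 0 ≤ T := (ContinuousLinearMap.nonneg_iff_isPositive T).2 hT.isPositive
  obtain ⟨S, hS, hST⟩ : ∃ S : H →L[ℂ] H, star S = S ∧ S * S = T :=
    ⟨CFC.sqrt T, (IsSelfAdjoint.of_nonneg (CFC.sqrt_nonneg T)).star_eq,
      CFC.sqrt_mul_sqrt_self T hpos⟩
  have hinner : ∀ u v, inner ℂ (S u) v = inner ℂ u (S v) := by
    intro u v
    rw [← ContinuousLinearMap.adjoint_inner_right, ← ContinuousLinearMap.star_eq_adjoint, hS]
  have hTS : ∀ v, T v = S (S v) := fun v => by rw [← hST]; rfl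
  refine ⟨fun i => S (basis H i), ⟨?_, fun u v => ?_⟩, fun B hB i => ?_⟩
  · have h1 : (fun i : basisSet H => inner ℂ (basis H i) (T (basis H i))) =
        fun i => ((‖S (basis H i)‖ ^ 2 : ℝ) : ℂ) := by
      funext i
      rw [hTS, ← hinner, inner_self_eq_norm_sq_to_K]
      push_cast
      rfl
    have h2 := hT.hasSum_one.summable
    rw [h1] at h2
    exact Complex.summable_ofReal.1 h2
  · have h1 := (basis H).hasSum_inner_mul_inner (S u) (S v)
    rw [hinner, ← hTS] at h1
    simpa only [hinner] using h1
  · have h1 : (B * S) * star (B * S) = 0 := by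
      rw [star_mul, hS, mul_assoc, ← mul_assoc S, hST, ← mul_assoc]
      have : B * T = 0 := hB
      rw [this, zero_mul]
    have h2 : B * S = 0 := CStarRing.mul_star_self_eq_zero_iff _ |>.1 h1
    exact congrArg (fun A : H →L[ℂ] H => A (basis H i)) h2

end Hilbert

/-! ### Bounded coefficient maps into L² -/

section ClosedGraph

variable {H : Type*} [NormedAddCommGroup H] [InnerProductSpace ℂ H] [CompleteSpace H]

/-- A family of functionals whose values are square integrable defines a bounded operator into
`L²`, by the closed graph theorem. -/
theorem exists_clm_toL2 {X : Type*} [MeasurableSpace X] {α : Measure X} (φ : X → H →L[ℂ] ℂ)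
    (hφ : ∀ v, MemLp (fun x => φ x v) 2 α) :
    ∃ L : H →L[ℂ] Lp ℂ 2 α, ∀ v, L v =ᵐ[α] fun x => φ x v := by
  let L : H →ₗ[ℂ] Lp ℂ 2 α :=
    { toFun := fun v => (hφ v).toLp _
      map_add' := fun v w => by
        rw [← MemLp.toLp_add]
        exact MemLp.toLp_congr _ _ (Filter.Eventually.of_forall fun x => by simp)
      map_smul' := fun a v => by
        rw [RingHom.id_apply, ← MemLp.toLp_const_smul]
        exact MemLp.toLp_congr _ _ (Filter.Eventually.of_forall fun x => by simp) }
  have hL : ∀ v, L v =ᵐ[α] fun x => φ x v := fun v => (hφ v).coeFn_toLp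
  refine ⟨⟨L, L.continuous_of_seq_closed_graph fun u v f hu hf => ?_⟩, hL⟩
  -- An L² limit is an almost everywhere limit along a subsequence, while continuity of each φ x
  -- fixes the pointwise limit; the two must agree.
  obtain ⟨ns, hns, hlim⟩ := (tendstoInMeasure_of_tendsto_Lp hf).exists_seq_tendsto_ae
  apply Lp.ext
  filter_upwards [hlim, hL v, ae_all_iff.2 fun n => hL (u n)] with x hx hv hun
  rw [hv]
  refine tendsto_nhds_unique hx ?_
  simp only [Function.comp_apply, hun]
  exact ((φ x).continuous.tendsto v).comp (hu.comp hns.tendsto_atTop)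

end ClosedGraph

/-! ### Action of the centre and passage to the quotient -/

section Center

variable {G : Type*} [Group G] {H : Type*} [NormedAddCommGroup H] [InnerProductSpace ℂ H]
  [CompleteSpace H] {π : G →* unitary (H →L[ℂ] H)}

theorem IsIrreducible.exists_smul_of_commute (hirr : IsIrreducible π) {z : G}
    (hz : ∀ g, Commute (π z : H →L[ℂ] H) (π g : H →L[ℂ] H)) :
    ∃ a : ℂ, conj a * a = 1 ∧ ∀ v, (π z : H →L[ℂ] H) v = a • v := by
  obtain ⟨a, ha⟩ := hirr.exists_eq_smul hz
  have hv : ∀ v, (π z : H →L[ℂ] H) v = a • v := fun v => by rw [ha]; rfl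
  refine ⟨a, ?_, hv⟩
  obtain ⟨v, hv0⟩ := @exists_ne _ hirr.1 (0 : H)
  have h := unitary_inner_map_map (π z) v v
  rw [hv, inner_smul_left, inner_smul_right, ← mul_assoc] at h
  exact mul_right_cancel₀ (inner_self_ne_zero.2 hv0) (by rw [h, one_mul])

theorem IsIrreducible.exists_smul_of_mem_center (hirr : IsIrreducible π) {z : G}
    (hz : z ∈ Subgroup.center G) :
    ∃ a : ℂ, conj a * a = 1 ∧ ∀ v, (π z : H →L[ℂ] H) v = a • v := by
  refine hirr.exists_smul_of_commute fun g => ?_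
  have h := Subgroup.mem_center_iff.1 hz g
  have h2 := congrArg (fun x : unitary (H →L[ℂ] H) => (x : H →L[ℂ] H)) (congrArg π h.symm)
  rw [map_mul, map_mul] at h2
  exact h2

/-- Products of a coefficient and a conjugate coefficient are functions on the quotient by the
centre. -/
theorem IsIrreducible.inner_mul_conj_inner_mul_center (hirr : IsIrreducible π) (h : G) {z : G}
    (hz : z ∈ Subgroup.center G) (u v u' v' : H) :
    inner ℂ ((π (h * z) : H →L[ℂ] H) u) v * conj (inner ℂ ((π (h * z) : H →L[ℂ] H) u') v') =
      inner ℂ ((π h : H →L[ℂ] H) u) v * conj (inner ℂ ((π h : H →L[ℂ] H) u') v') := by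
  obtain ⟨a, ha, hav⟩ := hirr.exists_smul_of_mem_center hz
  rw [rep_mul_apply, rep_mul_apply, hav, hav, map_smul, map_smul, inner_smul_left,
    inner_smul_left, map_mul, Complex.conj_conj]
  linear_combination inner ℂ ((π h : H →L[ℂ] H) u) v * conj (inner ℂ ((π h : H →L[ℂ] H) u') v') * ha

end Center

section Quotient

variable {G : Type*} [Group G] {s : G ⧸ Subgroup.center G → G}

/-- This makes the section harmless: on functions invariant under the centre, composing with `s` is
descent to G/Z. Hence they inherit continuity and translation behaviour although `s` is only Borel.
-/
theorem comp_section_mk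
    (hsection : ∀ x : G ⧸ Subgroup.center G, (QuotientGroup.mk (s x) : G ⧸ Subgroup.center G) = x)
    {E : Type*} {Φ : G → E}
    (hΦ : ∀ h, ∀ z ∈ Subgroup.center G, Φ (h * z) = Φ h) (h : G) :
    Φ (s (QuotientGroup.mk h)) = Φ h := by
  have hz : h⁻¹ * s (QuotientGroup.mk h) ∈ Subgroup.center G :=
    QuotientGroup.eq.1 (hsection (QuotientGroup.mk h)).symm
  simpa using hΦ h _ hz

theorem continuous_comp_section
    (hsection : ∀ x : G ⧸ Subgroup.center G, (QuotientGroup.mk (s x) : G ⧸ Subgroup.center G) = x)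
    [TopologicalSpace G] {E : Type*} [TopologicalSpace E] {Φ : G → E}
    (hc : Continuous Φ) (hΦ : ∀ h, ∀ z ∈ Subgroup.center G, Φ (h * z) = Φ h) :
    Continuous fun x => Φ (s x) := by
  refine continuous_coinduced_dom.2 ?_
  convert hc using 1
  funext h
  exact comp_section_mk hsection hΦ h

theorem integral_comp_section_mul_left
    (hsection : ∀ x : G ⧸ Subgroup.center G, (QuotientGroup.mk (s x) : G ⧸ Subgroup.center G) = x)
    [TopologicalSpace G] [IsTopologicalGroup G]
    [MeasurableSpace (G ⧸ Subgroup.center G)] [BorelSpace (G ⧸ Subgroup.center G)]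
    {α : Measure (G ⧸ Subgroup.center G)} [α.IsMulLeftInvariant] {Φ : G → ℂ}
    (hΦ : ∀ h, ∀ z ∈ Subgroup.center G, Φ (h * z) = Φ h) (g : G) :
    ∫ x, Φ (g * s x) ∂α = ∫ x, Φ (s x) ∂α := by
  rw [← integral_mul_left_eq_self (fun x => Φ (s x)) (QuotientGroup.mk g)]
  congr 1
  funext x
  rw [← comp_section_mk hsection hΦ (g * s x)]
  congr 2
  rw [QuotientGroup.mk_mul, hsection]

/-- Uniqueness of Haar measure: a right translate of α is a multiple of α. The factor is shown to be
1 only inside the proof of the orthogonality relations. -/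
theorem exists_integral_comp_section_mul_right
    (hsection : ∀ x : G ⧸ Subgroup.center G, (QuotientGroup.mk (s x) : G ⧸ Subgroup.center G) = x)
    [TopologicalSpace G] [IsTopologicalGroup G]
    [LocallyCompactSpace G] [SecondCountableTopology G]
    [MeasurableSpace (G ⧸ Subgroup.center G)] [BorelSpace (G ⧸ Subgroup.center G)]
    (α : Measure (G ⧸ Subgroup.center G)) [α.IsHaarMeasure] (g : G) :
    ∃ Δ : ℝ, 0 ≤ Δ ∧ ∀ Φ : G → ℂ, (∀ h, ∀ z ∈ Subgroup.center G, Φ (h * z) = Φ h) →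
    ∫ x, Φ (s x * g) ∂α = Δ * ∫ x, Φ (s x) ∂α := by
  obtain ⟨c, hc⟩ : ∃ c : NNReal, Measure.map (· * (QuotientGroup.mk g)) α = c • α :=
    ⟨_, Measure.isMulLeftInvariant_eq_smul _ α⟩
  refine ⟨c, NNReal.coe_nonneg c, fun Φ hΦ => ?_⟩
  have h2 : ∫ x, Φ (s x * g) ∂α = ∫ x, Φ (s (x * QuotientGroup.mk g)) ∂α := by
    congr 1
    funext x
    rw [← comp_section_mk hsection hΦ (s x * g)]
    congr 2
    rw [QuotientGroup.mk_mul, hsection]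
  have h3 : ∫ x, Φ (s x) ∂(Measure.map (· * (QuotientGroup.mk g)) α) =
      ∫ x, Φ (s (x * QuotientGroup.mk g)) ∂α :=
    (MeasurableEquiv.mulRight
      (QuotientGroup.mk g : G ⧸ Subgroup.center G)).measurableEmbedding.integral_map
      (fun x => Φ (s x))
  rw [h2, ← h3, hc, integral_smul_nnreal_measure]
  rfl

end Quotient

/-! ### Orthogonality relations -/

section Orthogonality

variable {G : Type*} [Group G] [TopologicalSpace G] [IsTopologicalGroup G]
  [MeasurableSpace (G ⧸ Subgroup.center G)] [BorelSpace (G ⧸ Subgroup.center G)]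
  {α : Measure (G ⧸ Subgroup.center G)} [α.IsHaarMeasure] {s : G ⧸ Subgroup.center G → G}
  {H : Type*} [NormedAddCommGroup H] [InnerProductSpace ℂ H] [CompleteSpace H]
  {π : G →* unitary (H →L[ℂ] H)}

/-- Orthogonality relations in the second variables. -/
theorem IsIrreducible.exists_integral_inner_mul_conj_inner_left
    (hsection : ∀ x : G ⧸ Subgroup.center G, (QuotientGroup.mk (s x) : G ⧸ Subgroup.center G) = x)
    (hirr : IsIrreducible π) (hsq : IsSquareIntegrableModCenter π s α) (u u' : H) :
    ∃ C : ℂ, ∀ v v' : H, ∫ x, inner ℂ ((π (s x) : H →L[ℂ] H) u) v *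
      conj (inner ℂ ((π (s x) : H →L[ℂ] H) u') v') ∂α = C * inner ℂ v' v := by
  obtain ⟨M, hM⟩ := exists_clm_toL2 (fun x => innerSL ℂ ((π (s x) : H →L[ℂ] H) u)) (hsq u)
  obtain ⟨M', hM'⟩ := exists_clm_toL2 (fun x => innerSL ℂ ((π (s x) : H →L[ℂ] H) u')) (hsq u')
  have hint : ∀ v v', inner ℂ v' ((ContinuousLinearMap.adjoint M' ∘L M) v) =
      ∫ x, inner ℂ ((π (s x) : H →L[ℂ] H) u) v *
        conj (inner ℂ ((π (s x) : H →L[ℂ] H) u') v') ∂α := by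
    intro v v'
    rw [ContinuousLinearMap.comp_apply, ContinuousLinearMap.adjoint_inner_right, L2.inner_def]
    refine integral_congr_ae ?_
    filter_upwards [hM v, hM' v'] with x h1 h2
    rw [h1, h2]
    rfl
  -- Left invariance of α makes M'* M commute with π, so Schur's lemma makes it a scalar, depending
  -- on u and u' only.
  obtain ⟨C, hC⟩ := hirr.exists_eq_smul (A := ContinuousLinearMap.adjoint M' ∘L M) (fun g => by
    ext v
    refine ext_inner_left ℂ fun w => ?_
    change inner ℂ w ((ContinuousLinearMap.adjoint M' ∘L M) ((π g : H →L[ℂ] H) v)) =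
      inner ℂ w ((π g : H →L[ℂ] H) ((ContinuousLinearMap.adjoint M' ∘L M) v))
    rw [← inv_inv g, ← rep_inner_left π g⁻¹, hint, hint]
    rw [← integral_comp_section_mul_left hsection (Φ := fun h =>
      inner ℂ ((π h : H →L[ℂ] H) u) v *
        conj (inner ℂ ((π h : H →L[ℂ] H) u') ((π g⁻¹ : H →L[ℂ] H) w)))
      (fun h z hz => hirr.inner_mul_conj_inner_mul_center h hz _ _ _ _) g⁻¹]
    congr 1
    funext x
    rw [rep_mul_apply, rep_mul_apply, unitary_inner_map_map, rep_inner_left π g⁻¹])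
  refine ⟨C, fun v v' => ?_⟩
  rw [← hint, hC, smul_apply, inner_smul_right]
  rfl

/-- Orthogonality relations for square integrable representations. -/
theorem IsIrreducible.exists_integral_inner_mul_conj_inner
    [LocallyCompactSpace G] [SecondCountableTopology G]
    (hsection : ∀ x : G ⧸ Subgroup.center G, (QuotientGroup.mk (s x) : G ⧸ Subgroup.center G) = x)
    (hcont : ∀ v : H, Continuous fun g : G => (π g : H →L[ℂ] H) v)
    (hirr : IsIrreducible π) (hsq : IsSquareIntegrableModCenter π s α) :
    ∃ d : ℝ, 0 < d ∧ ∀ u v u' v' : H, ∫ x, inner ℂ ((π (s x) : H →L[ℂ] H) u) v *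
      conj (inner ℂ ((π (s x) : H →L[ℂ] H) u') v') ∂α = d * (inner ℂ u u' * inner ℂ v' v) := by
  choose C hC using hirr.exists_integral_inner_mul_conj_inner_left hsection hsq
  have := hirr.1
  obtain ⟨w, hw⟩ := exists_norm_eq H (zero_le_one (α := ℝ))
  have hww : inner ℂ w w = (1 : ℂ) := by
    rw [inner_self_eq_norm_sq_to_K, hw]; simp
  have hmem : ∀ u, MemLp (fun x => (innerSL ℂ w ∘L (π (s x) : H →L[ℂ] H)) u) 2 α := by
    intro u
    refine (hsq u w).congr_norm ?_ (Filter.Eventually.of_forall fun x => norm_inner_symm _ _)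
    exact (continuous_star.comp_aestronglyMeasurable (hsq u w).1).congr
      (Filter.Eventually.of_forall fun x => inner_conj_symm _ _)
  obtain ⟨N, hN⟩ := exists_clm_toL2 _ hmem
  have hint : ∀ u u', inner ℂ u ((ContinuousLinearMap.adjoint N ∘L N) u') = C u u' := by
    intro u u'
    rw [← mul_one (C u u'), ← hww, ← hC, ContinuousLinearMap.comp_apply,
      ContinuousLinearMap.adjoint_inner_right, L2.inner_def]
    refine integral_congr_ae ?_
    filter_upwards [hN u, hN u'] with x h1 h2
    rw [h1, h2]
    change inner ℂ w _ * conj (inner ℂ w _) = _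
    rw [inner_conj_symm, ← inner_conj_symm ((π (s x) : H →L[ℂ] H) u') w, Complex.conj_conj, mul_comm]
    rfl
  set A : H →L[ℂ] H := ContinuousLinearMap.adjoint N ∘L N with hA
  -- If N w vanished, the coefficient of w would be zero almost everywhere. Its squared modulus is
  -- continuous on G/Z, so it would be zero everywhere, yet it equals 1 at the identity.
  have hpos : 0 < ‖N w‖ := by
    rw [norm_pos_iff]
    intro h0
    have h1 : (fun x => ‖inner ℂ ((π (s x) : H →L[ℂ] H) w) w *
        conj (inner ℂ ((π (s x) : H →L[ℂ] H) w) w)‖) =ᵐ[α] fun _ => 0 := by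
      have h2 := hN w
      rw [h0] at h2
      filter_upwards [h2, Lp.coeFn_zero ℂ 2 α] with x hx hx0
      rw [hx0] at hx
      have hx' : inner ℂ w ((π (s x) : H →L[ℂ] H) w) = 0 := hx.symm
      rw [← inner_conj_symm, hx']
      simp
    have h3 := (Continuous.ae_eq_iff_eq α (continuous_comp_section hsection
      (Φ := fun h => ‖inner ℂ ((π h : H →L[ℂ] H) w) w *
        conj (inner ℂ ((π h : H →L[ℂ] H) w) w)‖)
      (by
        have := hcont w
        have h4 : Continuous fun h => inner ℂ ((π h : H →L[ℂ] H) w) w := this.inner continuous_const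
        exact (h4.mul (Complex.continuous_conj.comp h4)).norm)
      (fun h z hz => by rw [hirr.inner_mul_conj_inner_mul_center h hz])) continuous_const).1 h1
    have h5 := congrFun h3 (QuotientGroup.mk 1)
    rw [comp_section_mk hsection
      (Φ := fun h => ‖inner ℂ ((π h : H →L[ℂ] H) w) w *
        conj (inner ℂ ((π h : H →L[ℂ] H) w) w)‖)
      (fun h z hz => by rw [hirr.inner_mul_conj_inner_mul_center h hz])] at h5
    simp only [rep_one_apply, hww] at h5
    simp at h5
  have hAw : inner ℂ w (A w) = ((‖N w‖ ^ 2 : ℝ) : ℂ) := by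
    rw [hA, ContinuousLinearMap.comp_apply, ContinuousLinearMap.adjoint_inner_right,
      inner_self_eq_norm_sq_to_K]
    push_cast
    rfl
  have hAne : ‖A‖ ≠ 0 := by
    rw [norm_ne_zero_iff]
    intro h0
    rw [h0, zero_apply, inner_zero_right] at hAw
    exact (pow_pos hpos 2).ne (Complex.ofReal_eq_zero.1 hAw.symm).symm
  -- Right translation gives π(g)⁻¹ A π(g) = Δ A. Conjugation by a unitary preserves the norm of A,
  -- which is nonzero, so Δ = 1.
  have hcomm : ∀ g, (π g⁻¹ : H →L[ℂ] H) * A * (π g : H →L[ℂ] H) = A := by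
    intro g
    obtain ⟨Δ, hΔ0, hΔ⟩ := exists_integral_comp_section_mul_right hsection α g
    have h1 : (π g⁻¹ : H →L[ℂ] H) * A * (π g : H →L[ℂ] H) = (Δ : ℂ) • A := by
      ext v
      refine ext_inner_left ℂ fun u => ?_
      change inner ℂ u ((π g⁻¹ : H →L[ℂ] H) (A ((π g : H →L[ℂ] H) v))) = inner ℂ u ((Δ : ℂ) • A v)
      rw [← rep_inner_left, inner_smul_right, hint, hint, ← mul_one (C _ _), ← mul_one (C u v),
        ← hww, ← hC, ← hC, ← hΔ (fun h => inner ℂ ((π h : H →L[ℂ] H) u) w *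
          conj (inner ℂ ((π h : H →L[ℂ] H) v) w))
        (fun h z hz => hirr.inner_mul_conj_inner_mul_center h hz _ _ _ _)]
      simp only [rep_mul_apply]
    have h2 : ‖A‖ = Δ * ‖A‖ := by
      have h3 := congrArg norm h1
      rwa [CStarRing.norm_mul_coe_unitary, CStarRing.norm_coe_unitary_mul, norm_smul,
        Complex.norm_real, Real.norm_of_nonneg hΔ0] at h3
    have h4 : Δ = 1 := mul_right_cancel₀ hAne (by rw [one_mul]; exact h2.symm)
    rw [h1, h4, Complex.ofReal_one, one_smul]
  obtain ⟨d, hd⟩ := hirr.exists_eq_smul (A := A) (fun g => by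
    have h := congrArg (fun B => (π g : H →L[ℂ] H) * B) (hcomm g)
    ext v
    have h2 := congrArg (fun B : H →L[ℂ] H => B v) h
    change (π g : H →L[ℂ] H) ((π g⁻¹ : H →L[ℂ] H) (A ((π g : H →L[ℂ] H) v))) = _ at h2
    rwa [rep_self_apply_inv] at h2)
  have hdr : d = ((‖N w‖ ^ 2 : ℝ) : ℂ) := by
    rw [← hAw, hd, smul_apply, inner_smul_right]
    change d = d * inner ℂ w w
    rw [hww, mul_one]
  refine ⟨‖N w‖ ^ 2, pow_pos hpos 2, fun u v u' v' => ?_⟩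
  rw [hC, ← hint, hd, smul_apply, inner_smul_right, hdr, mul_assoc]
  rfl

end Orthogonality

/-! ### Termwise integration -/

section Series

theorem integrable_and_hasSum_integral {X ι : Type*} [MeasurableSpace X] {α : Measure X}
    [Countable ι] {F : ι → X → ℂ} {f : X → ℂ} (hF : ∀ i, Integrable (F i) α)
    (hsum : Summable fun i => ∫ x, ‖F i x‖ ∂α) (hf : ∀ x, HasSum (fun i => F i x) (f x)) :
    Integrable f α ∧ HasSum (fun i => ∫ x, F i x ∂α) (∫ x, f x ∂α) := by
  have hfe : f = fun x => ∑' i, F i x := funext fun x => (hf x).tsum_eq.symm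
  refine ⟨⟨?_, ?_⟩, ?_⟩
  · refine aestronglyMeasurable_of_tendsto_ae Filter.atTop
      (f := fun (S : Finset ι) x => ∑ i ∈ S, F i x) (fun S => ?_) (Filter.Eventually.of_forall hf)
    exact Finset.aestronglyMeasurable_fun_sum S fun i _ => (hF i).1
  · have h1 : ∀ i, ∫⁻ x, ‖F i x‖ₑ ∂α = ENNReal.ofReal (∫ x, ‖F i x‖ ∂α) := fun i =>
      (ofReal_integral_norm_eq_lintegral_enorm (hF i)).symm
    have h2 : ∫⁻ x, ‖f x‖ₑ ∂α ≤ ∑' i, ENNReal.ofReal (∫ x, ‖F i x‖ ∂α) := by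
      rw [← tsum_congr h1, ← lintegral_tsum fun i => (hF i).1.enorm]
      refine lintegral_mono fun x => ?_
      rw [hfe]
      exact enorm_tsum_le_tsum_enorm
    refine lt_of_le_of_lt h2 ?_
    rw [← ENNReal.ofReal_tsum_of_nonneg (fun i => integral_nonneg fun x => norm_nonneg _) hsum]
    exact ENNReal.ofReal_lt_top
  · rw [hfe]
    exact hasSum_integral_of_summable_integral_norm hF hsum

end Series

/-! ### Integrability of coefficients and existence of the weak integral -/

section Coefficients

variable {G : Type*} [Group G] [MeasurableSpace (G ⧸ Subgroup.center G)]
  {α : Measure (G ⧸ Subgroup.center G)} {s : G ⧸ Subgroup.center G → G}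
  {H : Type*} [NormedAddCommGroup H] [InnerProductSpace ℂ H] [CompleteSpace H]
  {π : G →* unitary (H →L[ℂ] H)}

/-- The representation satisfies the orthogonality relations with the constant `d`, the inverse
of its formal degree. -/
structure HasOrthogonality (π : G →* unitary (H →L[ℂ] H))
    (s : G ⧸ Subgroup.center G → G) (α : Measure (G ⧸ Subgroup.center G)) (d : ℝ) : Prop where
  sq : IsSquareIntegrableModCenter π s α
  pos : 0 < d
  integral_eq : ∀ u v u' v' : H, ∫ x, inner ℂ ((π (s x) : H →L[ℂ] H) u) v *
      conj (inner ℂ ((π (s x) : H →L[ℂ] H) u') v') ∂α = d * (inner ℂ u u' * inner ℂ v' v)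

variable {d : ℝ}

theorem HasOrthogonality.integrable (h : HasOrthogonality π s α d) (u v u' v' : H) :
    Integrable (fun x => inner ℂ ((π (s x) : H →L[ℂ] H) u) v *
      conj (inner ℂ ((π (s x) : H →L[ℂ] H) u') v')) α :=
  (h.sq u v).integrable_mul (h.sq u' v').star

theorem HasOrthogonality.integral_norm_sq (h : HasOrthogonality π s α d) (u v : H) :
    ∫ x, ‖inner ℂ ((π (s x) : H →L[ℂ] H) u) v‖ ^ (2 : ℝ) ∂α = d * (‖u‖ * ‖v‖) ^ 2 := by
  have h1 := h.integral_eq u v u v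
  simp_rw [RCLike.mul_conj] at h1
  rw [inner_self_eq_norm_sq_to_K, inner_self_eq_norm_sq_to_K] at h1
  have h2 : (∫ x, ‖inner ℂ ((π (s x) : H →L[ℂ] H) u) v‖ ^ 2 ∂α) = d * (‖u‖ ^ 2 * ‖v‖ ^ 2) := by
    have h3 : ((∫ x, ‖inner ℂ ((π (s x) : H →L[ℂ] H) u) v‖ ^ 2 ∂α : ℝ) : ℂ) =
        ((d * (‖u‖ ^ 2 * ‖v‖ ^ 2) : ℝ) : ℂ) := by
      rw [← integral_complex_ofReal]
      push_cast
      exact h1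
    exact_mod_cast h3
  simp only [Real.rpow_two]
  rw [h2]
  ring

theorem HasOrthogonality.integral_norm_le (h : HasOrthogonality π s α d) (u v u' v' : H) :
    ∫ x, ‖inner ℂ ((π (s x) : H →L[ℂ] H) u) v *
      conj (inner ℂ ((π (s x) : H →L[ℂ] H) u') v')‖ ∂α ≤ d * (‖u‖ * ‖v‖ * (‖u'‖ * ‖v'‖)) := by
  have h2 : ENNReal.ofReal 2 = 2 := by simp
  have h1 := integral_mul_norm_le_Lp_mul_Lq (μ := α) Real.HolderConjugate.two_two
    (f := fun x => inner ℂ ((π (s x) : H →L[ℂ] H) u) v)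
    (g := fun x => inner ℂ ((π (s x) : H →L[ℂ] H) u') v')
    (by rw [h2]; exact h.sq u v) (by rw [h2]; exact h.sq u' v')
  rw [h.integral_norm_sq, h.integral_norm_sq, ← Real.sqrt_eq_rpow, ← Real.sqrt_eq_rpow,
    ← Real.sqrt_mul (mul_nonneg h.pos.le (sq_nonneg _)),
    show d * (‖u‖ * ‖v‖) ^ 2 * (d * (‖u'‖ * ‖v'‖) ^ 2) =
      (d * (‖u‖ * ‖v‖ * (‖u'‖ * ‖v'‖))) ^ 2 by ring,
    Real.sqrt_sq (mul_nonneg h.pos.le (by positivity))] at h1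
  simpa only [norm_mul, RCLike.norm_conj] using h1

/-- Each rank one term is bounded by Cauchy–Schwarz and orthogonality, and the bounds add up to the
trace of T. The explicit estimate bounds the form defining Q_T(E). -/
theorem HasOrthogonality.integrable_rep (h : HasOrthogonality π s α d) {ι : Type*} [Countable ι]
    {T : H →L[ℂ] H} {t : ι → H} (hT : IsRankOneSum T t) (u v : H) :
    Integrable (fun x => inner ℂ u ((π (s x) : H →L[ℂ] H) (T ((π (s x)⁻¹ : H →L[ℂ] H) v)))) α ∧
    ∫ x, ‖inner ℂ u ((π (s x) : H →L[ℂ] H) (T ((π (s x)⁻¹ : H →L[ℂ] H) v)))‖ ∂α ≤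
      d * (∑' i, ‖t i‖ ^ 2) * (‖u‖ * ‖v‖) := by
  have hle : ∀ i, ∫ x, ‖inner ℂ ((π (s x) : H →L[ℂ] H) (t i)) v *
      conj (inner ℂ ((π (s x) : H →L[ℂ] H) (t i)) u)‖ ∂α ≤ d * ‖t i‖ ^ 2 * (‖u‖ * ‖v‖) := fun i =>
    (h.integral_norm_le _ _ _ _).trans_eq (by ring)
  have hs := (hT.summable.mul_left d).mul_right (‖u‖ * ‖v‖)
  have hs' : Summable fun i => ∫ x, ‖inner ℂ ((π (s x) : H →L[ℂ] H) (t i)) v *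
      conj (inner ℂ ((π (s x) : H →L[ℂ] H) (t i)) u)‖ ∂α :=
    Summable.of_nonneg_of_le (fun i => integral_nonneg fun x => norm_nonneg _) hle hs
  have hint := (integrable_and_hasSum_integral (fun i => h.integrable (t i) v (t i) u) hs'
    fun x => hT.hasSum_rep π (s x) u v).1
  refine ⟨hint, ?_⟩
  have hpt : ∀ x, Summable fun i => ‖inner ℂ ((π (s x) : H →L[ℂ] H) (t i)) v *
      conj (inner ℂ ((π (s x) : H →L[ℂ] H) (t i)) u)‖ := fun x =>
    (hT.hasSum_rep π (s x) u v).summable.norm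
  have h2 := (integrable_and_hasSum_integral
    (F := fun i x => ((‖inner ℂ ((π (s x) : H →L[ℂ] H) (t i)) v *
      conj (inner ℂ ((π (s x) : H →L[ℂ] H) (t i)) u)‖ : ℝ) : ℂ))
    (fun i => (h.integrable (t i) v (t i) u).norm.ofReal)
    (by simpa only [Complex.norm_real, norm_norm] using hs')
    fun x => Complex.hasSum_ofReal.2 (hpt x).hasSum)
  have h3 : HasSum (fun i => ∫ x, ‖inner ℂ ((π (s x) : H →L[ℂ] H) (t i)) v *
      conj (inner ℂ ((π (s x) : H →L[ℂ] H) (t i)) u)‖ ∂α)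
      (∫ x, ∑' i, ‖inner ℂ ((π (s x) : H →L[ℂ] H) (t i)) v *
      conj (inner ℂ ((π (s x) : H →L[ℂ] H) (t i)) u)‖ ∂α) := by
    have h4 := h2.2
    simp only [integral_complex_ofReal] at h4
    exact Complex.hasSum_ofReal.1 h4
  have h5 : Integrable (fun x => ∑' i, ‖inner ℂ ((π (s x) : H →L[ℂ] H) (t i)) v *
      conj (inner ℂ ((π (s x) : H →L[ℂ] H) (t i)) u)‖) α := h2.1.re
  calc _ ≤ ∫ x, ∑' i, ‖inner ℂ ((π (s x) : H →L[ℂ] H) (t i)) v *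
      conj (inner ℂ ((π (s x) : H →L[ℂ] H) (t i)) u)‖ ∂α := by
        refine integral_mono hint.norm h5 fun x => ?_
        change ‖_‖ ≤ _
        rw [← (hT.hasSum_rep π (s x) u v).tsum_eq]
        exact norm_tsum_le_tsum_norm (hpt x)
    _ = ∑' i, ∫ x, ‖inner ℂ ((π (s x) : H →L[ℂ] H) (t i)) v *
      conj (inner ℂ ((π (s x) : H →L[ℂ] H) (t i)) u)‖ ∂α := h3.tsum_eq.symm
    _ ≤ ∑' i, d * ‖t i‖ ^ 2 * (‖u‖ * ‖v‖) := hs'.tsum_le_tsum hle hs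
    _ = _ := by rw [tsum_mul_right, tsum_mul_left]

theorem HasOrthogonality.exists_isWeakIntegral (h : HasOrthogonality π s α d) {ι : Type*}
    [Countable ι] {T : H →L[ℂ] H} {t : ι → H} (hT : IsRankOneSum T t)
    (E : Set (G ⧸ Subgroup.center G)) : ∃ A : H →L[ℂ] H, IsWeakIntegral π s α T E A := by
  let P : H → H → G ⧸ Subgroup.center G → ℂ := fun u v x =>
    inner ℂ u ((π (s x) : H →L[ℂ] H) (T ((π (s x)⁻¹ : H →L[ℂ] H) v)))
  have hP : ∀ u v, IntegrableOn (P u v) E α := fun u v => (h.integrable_rep hT u v).1.integrableOn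
  have hbound : ∀ u v, ‖∫ x in E, P u v x ∂α‖ ≤ d * (∑' i, ‖t i‖ ^ 2) * ‖u‖ * ‖v‖ := by
    intro u v
    calc ‖∫ x in E, P u v x ∂α‖ ≤ ∫ x in E, ‖P u v x‖ ∂α := norm_integral_le_integral_norm _
      _ ≤ ∫ x, ‖P u v x‖ ∂α := setIntegral_le_integral (h.integrable_rep hT u v).1.norm
          (Filter.Eventually.of_forall fun x => norm_nonneg _)
      _ ≤ _ := (h.integrable_rep hT u v).2.trans_eq (by ring)
  let B : H →ₗ⋆[ℂ] H →ₗ[ℂ] ℂ := LinearMap.mk₂'ₛₗ (starRingEnd ℂ) (RingHom.id ℂ)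
    (fun u v => ∫ x in E, P u v x ∂α)
    (fun u u' v => by
      rw [← integral_add (hP u v) (hP u' v)]
      simp only [P, inner_add_left])
    (fun a u v => by
      simp only [P, inner_smul_left, smul_eq_mul, integral_const_mul])
    (fun u v v' => by
      rw [← integral_add (hP u v) (hP u v')]
      simp only [P, map_add, inner_add_right])
    (fun a u v => by
      simp only [P, map_smul, inner_smul_right, RingHom.id_apply, smul_eq_mul, integral_const_mul])
  -- The Riesz operator of a sesquilinear form stands in the left slot of the inner product; the
  -- adjoint moves it to the right slot.
  refine ⟨ContinuousLinearMap.adjoint (InnerProductSpace.continuousLinearMapOfBilin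
    (LinearMap.mkContinuous₂ B _ hbound)), fun u v => ⟨hP u v, ?_⟩⟩
  rw [ContinuousLinearMap.adjoint_inner_right,
    InnerProductSpace.continuousLinearMapOfBilin_apply]
  rfl

theorem isWeakIntegral_covariantPOM {T : H →L[ℂ] H} {E : Set (G ⧸ Subgroup.center G)}
    (h : ∃ A : H →L[ℂ] H, IsWeakIntegral π s α T E A) :
    IsWeakIntegral π s α T E (covariantPOM π s α T E) := by
  rw [covariantPOM, dif_pos h]
  exact h.choose_spec

end Coefficients

/-! ### The functions tr[W π(g)] and tr[W π(g) T π(g)⁻¹] -/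

section Transform

variable {G : Type*} [Group G]
  {H : Type*} [NormedAddCommGroup H] [InnerProductSpace ℂ H] [CompleteSpace H]
  {ι κ : Type*}

/-- The function `g ↦ tr[T π(g)]` for `T = ∑ i, |t i⟩⟨t i|`. -/
noncomputable def coeffTrace (π : G →* unitary (H →L[ℂ] H)) (t : ι → H) (g : G) : ℂ :=
  ∑' i, inner ℂ (t i) ((π g : H →L[ℂ] H) (t i))

/-- The function `g ↦ tr[W π(g) T π(g)⁻¹]` for `W = ∑ i, |w i⟩⟨w i|`. -/
noncomputable def conjTrace (π : G →* unitary (H →L[ℂ] H)) (T : H →L[ℂ] H) (w : ι → H) (g : G) :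
    ℂ :=
  ∑' i, inner ℂ (w i) ((π g : H →L[ℂ] H) (T ((π g⁻¹ : H →L[ℂ] H) (w i))))

variable {π : G →* unitary (H →L[ℂ] H)} {t : ι → H}

theorem norm_inner_rep_le (g : G) (v : H) : ‖inner ℂ v ((π g : H →L[ℂ] H) v)‖ ≤ ‖v‖ ^ 2 := by
  refine (norm_inner_le_norm _ _).trans_eq ?_
  rw [rep_norm_apply, sq]

theorem norm_inner_conj_le (T : H →L[ℂ] H) (g : G) (v : H) :
    ‖inner ℂ v ((π g : H →L[ℂ] H) (T ((π g⁻¹ : H →L[ℂ] H) v)))‖ ≤ ‖T‖ * ‖v‖ ^ 2 := by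
  refine (norm_inner_le_norm _ _).trans ?_
  rw [rep_norm_apply]
  have h := T.le_opNorm ((π g⁻¹ : H →L[ℂ] H) v)
  rw [rep_norm_apply] at h
  nlinarith [norm_nonneg v]

theorem summable_coeffTrace (ht : Summable fun i => ‖t i‖ ^ 2) (g : G) :
    Summable fun i => ‖inner ℂ (t i) ((π g : H →L[ℂ] H) (t i))‖ :=
  Summable.of_nonneg_of_le (fun _ => norm_nonneg _) (fun i => norm_inner_rep_le g (t i)) ht

theorem summable_conjTrace (T : H →L[ℂ] H) (ht : Summable fun i => ‖t i‖ ^ 2) (g : G) :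
    Summable fun i => inner ℂ (t i) ((π g : H →L[ℂ] H) (T ((π g⁻¹ : H →L[ℂ] H) (t i)))) :=
  Summable.of_norm_bounded (ht.mul_left ‖T‖) (fun i => norm_inner_conj_le T g (t i))

theorem continuous_coeffTrace [TopologicalSpace G]
    (hcont : ∀ v : H, Continuous fun g : G => (π g : H →L[ℂ] H) v)
    (ht : Summable fun i => ‖t i‖ ^ 2) : Continuous (coeffTrace π t) :=
  continuous_tsum (fun i => continuous_const.inner (hcont (t i))) ht
    fun i g => norm_inner_rep_le g (t i)

theorem continuous_conjTrace [TopologicalSpace G] [IsTopologicalGroup G]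
    (hcont : ∀ v : H, Continuous fun g : G => (π g : H →L[ℂ] H) v) (T : H →L[ℂ] H)
    (ht : Summable fun i => ‖t i‖ ^ 2) : Continuous (conjTrace π T t) := by
  refine continuous_tsum (fun i => ?_) (ht.mul_left ‖T‖) fun i g => norm_inner_conj_le T g (t i)
  have h : Continuous fun g : G => (π g⁻¹ : H →L[ℂ] H) (t i) := (hcont (t i)).comp continuous_inv
  have h2 := h.inner (𝕜 := ℂ) (T.continuous.comp h)
  refine h2.congr fun g => ?_
  rw [Function.comp_apply, rep_inner_left, inv_inv]

theorem IsIrreducible.conjTrace_mul_center (hirr : IsIrreducible π) (T : H →L[ℂ] H) (h : G) {z : G}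
    (hz : z ∈ Subgroup.center G) : conjTrace π T t (h * z) = conjTrace π T t h := by
  obtain ⟨a, ha, hav⟩ := hirr.exists_smul_of_mem_center hz
  have hinv : ∀ v, (π z⁻¹ : H →L[ℂ] H) v = conj a • v := by
    intro v
    have h1 := rep_inv_apply_self π z (conj a • v)
    rwa [hav, smul_smul, mul_comm, ha, one_smul] at h1
  unfold conjTrace
  congr 1
  funext i
  rw [mul_inv_rev, rep_mul_apply, rep_mul_apply, hinv, hav, map_smul, map_smul, map_smul,
    smul_smul, mul_comm, ha, one_smul]

theorem coeffTrace_mul_of_smul {a : ℂ} {z : G} (hav : ∀ v, (π z : H →L[ℂ] H) v = a • v)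
    (t : ι → H) (h : G) : coeffTrace π t (h * z) = a * coeffTrace π t h := by
  unfold coeffTrace
  rw [← tsum_mul_left]
  congr 1
  funext i
  rw [rep_mul_apply, hav, map_smul, inner_smul_right]

theorem conj_coeffTrace_mul_of_smul {a : ℂ} (ha : conj a * a = 1) {z : G}
    (hav : ∀ v, (π z : H →L[ℂ] H) v = a • v) (t : ι → H) (t' : κ → H) (h : G) :
    conj (coeffTrace π t' (h * z)) * coeffTrace π t (h * z) =
      conj (coeffTrace π t' h) * coeffTrace π t h := by
  rw [coeffTrace_mul_of_smul hav, coeffTrace_mul_of_smul hav, map_mul]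
  linear_combination conj (coeffTrace π t' h) * coeffTrace π t h * ha

theorem hasSum_coeffTrace (ht : Summable fun i => ‖t i‖ ^ 2) (g : G) :
    HasSum (fun i => inner ℂ (t i) ((π g : H →L[ℂ] H) (t i))) (coeffTrace π t g) :=
  (summable_coeffTrace (π := π) ht g).of_norm.hasSum

theorem hasSum_conj_coeffTrace (ht : Summable fun i => ‖t i‖ ^ 2) (g : G) :
    HasSum (fun i => inner ℂ ((π g : H →L[ℂ] H) (t i)) (t i)) (conj (coeffTrace π t g)) := by
  have h := Complex.hasSum_conj'.2 (hasSum_coeffTrace (π := π) ht g)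
  simpa only [inner_conj_symm] using h

variable [MeasurableSpace (G ⧸ Subgroup.center G)] {α : Measure (G ⧸ Subgroup.center G)}
  {s : G ⧸ Subgroup.center G → G} {d : ℝ}

/-- The density of `E ↦ tr[W Q_T(E)]`. -/
theorem HasOrthogonality.trace_comp_weakIntegral (h : HasOrthogonality π s α d) [Countable ι]
    [Countable κ] {T W : H →L[ℂ] H} {t : ι → H} {w : κ → H} (hT : IsRankOneSum T t)
    (hW : IsRankOneSum W w) :
    Integrable (fun x => conjTrace π T w (s x)) α ∧
    ∀ (E : Set (G ⧸ Subgroup.center G)) (A : H →L[ℂ] H), IsWeakIntegral π s α T E A →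
      trace (W ∘L A) = ∫ x in E, conjTrace π T w (s x) ∂α := by
  have hle : ∀ i, ∫ x, ‖inner ℂ (w i)
      ((π (s x) : H →L[ℂ] H) (T ((π (s x)⁻¹ : H →L[ℂ] H) (w i))))‖ ∂α ≤
      d * (∑' i, ‖t i‖ ^ 2) * ‖w i‖ ^ 2 := fun i =>
    (h.integrable_rep hT (w i) (w i)).2.trans_eq (by ring)
  have hs := hW.summable.mul_left (d * (∑' i, ‖t i‖ ^ 2))
  have hpt : ∀ x, HasSum (fun i => inner ℂ (w i)
      ((π (s x) : H →L[ℂ] H) (T ((π (s x)⁻¹ : H →L[ℂ] H) (w i))))) (conjTrace π T w (s x)) :=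
    fun x => (summable_conjTrace T hW.summable (s x)).hasSum
  refine ⟨(integrable_and_hasSum_integral (fun i => (h.integrable_rep hT (w i) (w i)).1)
    (Summable.of_nonneg_of_le (fun i => integral_nonneg fun x => norm_nonneg _) hle hs) hpt).1,
    fun E A hA => ?_⟩
  rw [hW.trace_comp]
  have hE := (integrable_and_hasSum_integral (α := α.restrict E)
    (fun i => (h.integrable_rep hT (w i) (w i)).1.integrableOn)
    (Summable.of_nonneg_of_le (fun i => integral_nonneg fun x => norm_nonneg _)
      (fun i => (setIntegral_le_integral (h.integrable_rep hT (w i) (w i)).1.norm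
          (Filter.Eventually.of_forall fun x => norm_nonneg _)).trans (hle i)) hs) hpt).2
  rw [← hE.tsum_eq]
  exact tsum_congr fun i => (hA (w i) (w i)).2

/-- Orthogonality relations for trace class operators. -/
theorem HasOrthogonality.integral_coeffTrace (h : HasOrthogonality π s α d) [Countable ι]
    [Countable κ] {t : ι → H} {w : κ → H} (ht : Summable fun i => ‖t i‖ ^ 2)
    (hw : Summable fun i => ‖w i‖ ^ 2) :
    Integrable (fun x => conj (coeffTrace π w (s x)) * coeffTrace π t (s x)) α ∧
    HasSum (fun p : κ × ι => (d : ℂ) * (inner ℂ (w p.1) (t p.2) * inner ℂ (t p.2) (w p.1)))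
      (∫ x, conj (coeffTrace π w (s x)) * coeffTrace π t (s x) ∂α) := by
  have hle : ∀ p : κ × ι, ∫ x, ‖inner ℂ ((π (s x) : H →L[ℂ] H) (w p.1)) (w p.1) *
      conj (inner ℂ ((π (s x) : H →L[ℂ] H) (t p.2)) (t p.2))‖ ∂α ≤
      d * (‖w p.1‖ ^ 2 * ‖t p.2‖ ^ 2) := fun p =>
    (h.integral_norm_le _ _ _ _).trans_eq (by ring)
  have hs := (hw.mul_of_nonneg ht (fun _ => sq_nonneg _) (fun _ => sq_nonneg _)).mul_left d
  have hpt : ∀ x, HasSum (fun p : κ × ι => inner ℂ ((π (s x) : H →L[ℂ] H) (w p.1)) (w p.1) *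
      conj (inner ℂ ((π (s x) : H →L[ℂ] H) (t p.2)) (t p.2)))
      (conj (coeffTrace π w (s x)) * coeffTrace π t (s x)) := by
    intro x
    have h1 := summable_coeffTrace (π := π) ht (s x)
    have h2 := summable_coeffTrace (π := π) hw (s x)
    have h3 : Summable fun i => ‖inner ℂ ((π (s x) : H →L[ℂ] H) (w i)) (w i)‖ := by
      simpa only [norm_inner_symm] using h2
    have h4 := summable_mul_of_summable_norm h3 h1
    have h5 := (hasSum_conj_coeffTrace (π := π) hw (s x)).mul
      (hasSum_coeffTrace (π := π) ht (s x)) h4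
    simp only [inner_conj_symm]
    exact h5
  have key := integrable_and_hasSum_integral
    (fun p : κ × ι => h.integrable (w p.1) (w p.1) (t p.2) (t p.2))
    (Summable.of_nonneg_of_le (fun i => integral_nonneg fun x => norm_nonneg _) hle hs) hpt
  refine ⟨key.1, ?_⟩
  simpa only [h.integral_eq] using key.2

/-- The orthogonality relation is applied to the vectors π(g) t i, which represent π(g) T π(g)⁻¹.
Summing over them first rebuilds the matrix elements of this operator in the vectors w i. -/
theorem HasOrthogonality.integral_coeffTrace_conj (h : HasOrthogonality π s α d) [Countable ι]
    [Countable κ] {T : H →L[ℂ] H} {t : ι → H} {w : κ → H} (hT : IsRankOneSum T t)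
    (hw : Summable fun i => ‖w i‖ ^ 2) (g : G) :
    ∫ x, conj (coeffTrace π w (s x)) * coeffTrace π t (g⁻¹ * s x * g) ∂α =
      d * conjTrace π T w g := by
  have ht' : Summable fun i => ‖(π g : H →L[ℂ] H) (t i)‖ ^ 2 := by
    simpa only [rep_norm_apply] using hT.summable
  have h1 := (h.integral_coeffTrace ht' hw).2
  have h2 : ∀ x, coeffTrace π (fun i => (π g : H →L[ℂ] H) (t i)) (s x) =
      coeffTrace π t (g⁻¹ * s x * g) := by
    intro x
    unfold coeffTrace
    congr 1
    funext i
    rw [rep_inner_left, rep_mul_apply, rep_mul_apply]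
  simp only [h2] at h1
  rw [← h1.tsum_eq, h1.summable.tsum_prod' fun i => ?_, conjTrace, ← tsum_mul_left]
  · refine tsum_congr fun i => ?_
    rw [tsum_mul_left, ← (hT.hasSum_rep π g (w i) (w i)).tsum_eq]
    congr 1
    refine tsum_congr fun j => ?_
    rw [inner_conj_symm, mul_comm]
  · have h3 := (hT.hasSum_rep π g (w i) (w i)).summable.mul_left (d : ℂ)
    refine h3.congr fun j => ?_
    rw [inner_conj_symm, mul_comm (inner ℂ _ (w i))]

end Transform

/-! ### The commutator subgroup acts by scalars; the commutator bicharacter -/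

section Commutator

variable {G : Type*} [Group G] {H : Type*} [NormedAddCommGroup H] [InnerProductSpace ℂ H]
  [CompleteSpace H] {π : G →* unitary (H →L[ℂ] H)} {c : commutator G →* Circle}

/-- A vector on which the commutator subgroup acts by `c` and whose coefficient does not vanish at
`g` forces `c` to be fixed under conjugation by `g`. -/
theorem character_conj_eq {t : H} (ht : ∀ k : commutator G, (π k : H →L[ℂ] H) t = (c k : ℂ) • t)
    {g : G} (hg : inner ℂ t ((π g : H →L[ℂ] H) t) ≠ 0) {k k' : commutator G}
    (hk : (k' : G) = g⁻¹ * k * g) : c k' = c k := by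
  have h1 : (π (k : G) : H →L[ℂ] H) ((π g : H →L[ℂ] H) t) = (c k' : ℂ) • (π g : H →L[ℂ] H) t := by
    rw [← map_smul, ← ht k', ← rep_mul_apply, ← rep_mul_apply, hk]
    congr 3
    group
  -- Unitarity of π(k) gives ⟪t, π(g)t⟫ = conj(c k) · c k' · ⟪t, π(g)t⟫, and the nonzero coefficient
  -- cancels.
  have h2 := unitary_inner_map_map (π (k : G)) t ((π g : H →L[ℂ] H) t)
  rw [h1, ht k, inner_smul_left, inner_smul_right, ← mul_assoc] at h2
  have h3 : conj (c k : ℂ) * (c k' : ℂ) = 1 := mul_right_cancel₀ hg (by rw [h2, one_mul])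
  rw [← Circle.coe_inv_eq_conj] at h3
  have h4 : (c k)⁻¹ * c k' = 1 := Circle.ext (by rw [Circle.coe_mul, h3, Circle.coe_one])
  exact (inv_mul_eq_one.1 h4).symm

/-- If the set of `g` with `tr[T π(g)] ≠ 0` has full measure, then the whole commutator subgroup
acts by scalars. -/
theorem IsIrreducible.commutator_apply [TopologicalSpace G] [IsTopologicalGroup G]
    [MeasurableSpace G] [BorelSpace G] (μ : Measure G) [μ.IsHaarMeasure]
    (hirr : IsIrreducible π) {ι : Type*} {t : ι → H}
    (ht : ∀ i, ∀ k : commutator G, (π k : H →L[ℂ] H) (t i) = (c k : ℂ) • t i)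
    (htr : ∀ᵐ g ∂μ, coeffTrace π t g ≠ 0) (k : commutator G) (v : H) :
    (π k : H →L[ℂ] H) v = (c k : ℂ) • v := by
  have hex : ∀ g, coeffTrace π t g ≠ 0 → ∃ i, inner ℂ (t i) ((π g : H →L[ℂ] H) (t i)) ≠ 0 := by
    intro g hg
    by_contra! h0
    exact hg (by simp only [coeffTrace, h0, tsum_zero])
  have hnorm : ∀ (g : G) (k : commutator G), g⁻¹ * k * g ∈ commutator G := by
    intro g k
    have h := (inferInstance : (commutator G).Normal).conj_mem k k.2 g⁻¹
    rwa [inv_inv] at h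
  have hstab : ∀ (h : G) (k k' : commutator G), (k' : G) = h⁻¹ * k * h → c k' = c k := by
    intro h k k' hk
    -- The set where the trace is nonzero has full measure, and so does its translate, so some g has
    -- both g and hg in it. Conjugations by g and by hg fix c, hence so does conjugation by h.
    have h1 : ∀ᵐ g ∂μ, coeffTrace π t (h * g) ≠ 0 :=
      (measurePreserving_mul_left μ h).quasiMeasurePreserving.ae htr
    obtain ⟨g, hg1, hg2⟩ := (htr.and h1).exists
    obtain ⟨i, hi⟩ := hex _ hg1
    obtain ⟨j, hj⟩ := hex _ hg2
    have e1 : c ⟨g⁻¹ * k' * g, hnorm g k'⟩ = c k' := character_conj_eq (ht i) hi rfl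
    have e2 : c ⟨g⁻¹ * k' * g, hnorm g k'⟩ = c k :=
      character_conj_eq (ht j) hj (by change g⁻¹ * (k' : G) * g = _; rw [hk]; group)
    exact e1.symm.trans e2
  let V : Submodule ℂ H :=
    { carrier := {v | ∀ k : commutator G, (π k : H →L[ℂ] H) v = (c k : ℂ) • v}
      add_mem' := fun {a b} ha hb k => by rw [map_add, ha k, hb k, smul_add]
      zero_mem' := fun k => by rw [map_zero, smul_zero]
      smul_mem' := fun a v hv k => by rw [map_smul, hv k, smul_comm] }
  have hclosed : IsClosed (V : Set H) := by
    have : (V : Set H) = ⋂ k : commutator G, {v | (π k : H →L[ℂ] H) v = (c k : ℂ) • v} := by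
      ext v
      simp [V]
    rw [this]
    exact isClosed_iInter fun k =>
      isClosed_eq (π k : H →L[ℂ] H).continuous (continuous_const_smul _)
  have hinv : ∀ g : G, ∀ v ∈ V, (π g : H →L[ℂ] H) v ∈ V := by
    intro g v hv k
    have h1 := hv ⟨g⁻¹ * k * g, hnorm g k⟩
    rw [hstab g k ⟨g⁻¹ * k * g, hnorm g k⟩ rfl] at h1
    rw [← map_smul, ← h1, ← rep_mul_apply, ← rep_mul_apply]
    congr 3
    group
  have hV : V = ⊤ := by
    refine (hirr.2 V hclosed hinv).resolve_left fun h0 => ?_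
    obtain ⟨g, hg⟩ := htr.exists
    obtain ⟨i, hi⟩ := hex g hg
    have hm : t i ∈ V := ht i
    rw [h0, Submodule.mem_bot] at hm
    exact hi (by rw [hm, inner_zero_left])
  have hv : v ∈ V := by rw [hV]; trivial
  exact hv k

/-- The value of `c` at the commutator of two elements. -/
noncomputable def commutatorPairing (c : commutator G →* Circle) (g h : G) : Circle :=
  c ⟨⁅g, h⁆, Subgroup.commutator_mem_commutator (Subgroup.mem_top g) (Subgroup.mem_top h)⟩

theorem rep_mul_comm_apply
    (hc : ∀ (k : commutator G) (v : H), (π k : H →L[ℂ] H) v = (c k : ℂ) • v)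
    (g h : G) (v : H) :
    (π (g * h) : H →L[ℂ] H) v = (commutatorPairing c g h : ℂ) • (π (h * g) : H →L[ℂ] H) v := by
  rw [commutatorPairing, ← hc, ← rep_mul_apply]
  congr 3
  simp only [commutatorElement_def]
  group

theorem commutatorPairing_eq
    (hc : ∀ (k : commutator G) (v : H), (π k : H →L[ℂ] H) v = (c k : ℂ) • v)
    [Nontrivial H] {g h : G} {a : Circle}
    (ha : ∀ v, (π (g * h) : H →L[ℂ] H) v = (a : ℂ) • (π (h * g) : H →L[ℂ] H) v) :
    commutatorPairing c g h = a := by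
  obtain ⟨v, hv⟩ := exists_ne (0 : H)
  have h1 := (rep_mul_comm_apply hc g h v).symm.trans (ha v)
  have h2 : (π (h * g) : H →L[ℂ] H) v ≠ 0 := by
    rw [← norm_ne_zero_iff, rep_norm_apply, norm_ne_zero_iff]
    exact hv
  exact Circle.ext (smul_left_injective ℂ h2 h1)

theorem commutatorPairing_mul_left
    (hc : ∀ (k : commutator G) (v : H), (π k : H →L[ℂ] H) v = (c k : ℂ) • v)
    [Nontrivial H] (g g' h : G) :
    commutatorPairing c (g * g') h = commutatorPairing c g h * commutatorPairing c g' h := by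
  refine commutatorPairing_eq hc fun v => ?_
  rw [mul_assoc, rep_mul_apply, rep_mul_comm_apply hc g' h, map_smul, ← rep_mul_apply,
    ← mul_assoc, rep_mul_apply, rep_mul_comm_apply hc g h, ← rep_mul_apply, smul_smul, mul_assoc,
    Circle.coe_mul, mul_comm (commutatorPairing c g h : ℂ)]

theorem commutatorPairing_mul_right
    (hc : ∀ (k : commutator G) (v : H), (π k : H →L[ℂ] H) v = (c k : ℂ) • v)
    [Nontrivial H] (g h h' : G) :
    commutatorPairing c g (h * h') = commutatorPairing c g h * commutatorPairing c g h' := by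
  refine commutatorPairing_eq hc fun v => ?_
  rw [← mul_assoc, rep_mul_apply, rep_mul_comm_apply hc g h, ← rep_mul_apply, mul_assoc,
    rep_mul_apply, rep_mul_comm_apply hc g h', map_smul, ← rep_mul_apply, smul_smul, mul_assoc,
    Circle.coe_mul]

theorem commutatorPairing_one_left
    (hc : ∀ (k : commutator G) (v : H), (π k : H →L[ℂ] H) v = (c k : ℂ) • v)
    [Nontrivial H] (h : G) : commutatorPairing c 1 h = 1 :=
  commutatorPairing_eq hc fun v => by simp

theorem continuous_commutatorPairing
    (hc : ∀ (k : commutator G) (v : H), (π k : H →L[ℂ] H) v = (c k : ℂ) • v)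
    [Nontrivial H] [TopologicalSpace G] [IsTopologicalGroup G]
    (hcont : ∀ v : H, Continuous fun g : G => (π g : H →L[ℂ] H) v) :
    Continuous fun p : G × G => commutatorPairing c p.1 p.2 := by
  obtain ⟨w, hw⟩ := exists_norm_eq H (zero_le_one (α := ℝ))
  have hww : inner ℂ w w = (1 : ℂ) := by
    rw [inner_self_eq_norm_sq_to_K, hw]; simp
  refine continuous_induced_rng.2 ?_
  have h1 : Continuous fun p : G × G => (π (p.1 * p.2 * p.1⁻¹ * p.2⁻¹) : H →L[ℂ] H) w :=
    (hcont w).comp (by fun_prop)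
  refine (continuous_const.inner (𝕜 := ℂ) h1 : Continuous fun p => inner ℂ w _).congr fun p => ?_
  have h2 := hc ⟨⁅p.1, p.2⁆, Subgroup.commutator_mem_commutator (Subgroup.mem_top p.1)
    (Subgroup.mem_top p.2)⟩ w
  simp only [commutatorElement_def] at h2
  rw [h2, inner_smul_right, hww, mul_one]
  rfl

/-- Conjugating the argument multiplies the function by a character; this is what turns
`HasOrthogonality.integral_coeffTrace_conj` into a Fourier coefficient. -/
theorem coeffTrace_conj
    (hc : ∀ (k : commutator G) (v : H), (π k : H →L[ℂ] H) v = (c k : ℂ) • v)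
    {ι : Type*} (t : ι → H) (g h : G) :
    coeffTrace π t (g * h * g⁻¹) = commutatorPairing c g h * coeffTrace π t h := by
  unfold coeffTrace
  rw [← tsum_mul_left]
  refine tsum_congr fun i => ?_
  have h1 := rep_mul_comm_apply hc g h ((π g⁻¹ : H →L[ℂ] H) (t i))
  rw [← rep_mul_apply, ← rep_mul_apply, mul_inv_cancel_right] at h1
  rw [h1, inner_smul_right]

/-- If the pairings with `h` and `h'` agree, then products of coefficients take the same values at
`h` and `h'`. -/
theorem conj_coeffTrace_eq_of_commutatorPairing_eq
    (hc : ∀ (k : commutator G) (v : H), (π k : H →L[ℂ] H) v = (c k : ℂ) • v)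
    (hirr : IsIrreducible π) {ι κ : Type*}
    (t : ι → H) (t' : κ → H) {h h' : G}
    (heq : ∀ g, commutatorPairing c g h = commutatorPairing c g h') :
    conj (coeffTrace π t' h') * coeffTrace π t h' =
      conj (coeffTrace π t' h) * coeffTrace π t h := by
  have := hirr.1
  -- The element h⁻¹h' pairs trivially with all of G, so its operator commutes with π and is a
  -- scalar of modulus one. The scalar cancels between the two factors.
  have h1 : ∀ g, commutatorPairing c g (h⁻¹ * h') = 1 := by
    intro g
    have h2 := commutatorPairing_mul_right hc g h (h⁻¹ * h')
    rw [mul_inv_cancel_left, ← heq] at h2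
    exact mul_eq_left.1 h2.symm
  obtain ⟨a, ha, hav⟩ := hirr.exists_smul_of_commute (z := h⁻¹ * h') fun g => by
    ext v
    have h3 := rep_mul_comm_apply hc g (h⁻¹ * h') v
    rw [h1, Circle.coe_one, one_smul, rep_mul_apply, rep_mul_apply π (h⁻¹ * h')] at h3
    exact h3.symm
  have h4 := conj_coeffTrace_mul_of_smul ha hav t t' h
  rwa [mul_inv_cancel_left] at h4

end Commutator

/-! ### Separating measures and saturated Borel sets -/

section Separation

open scoped BoundedContinuousFunction

/-- The images of S and of its complement need not be Borel, but they are disjoint analytic sets, so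
Lusin's theorem separates them by a Borel set. -/
theorem exists_measurableSet_preimage_eq {G E : Type*} [TopologicalSpace G] [PolishSpace G]
    [MeasurableSpace G] [BorelSpace G] [TopologicalSpace E] [T2Space E]
    [SecondCountableTopology E] [MeasurableSpace E] [BorelSpace E] {Φ : G → E} (hΦ : Measurable Φ)
    {S : Set G} (hS : MeasurableSet S) (hsat : ∀ g g', Φ g = Φ g' → g ∈ S → g' ∈ S) :
    ∃ B, MeasurableSet B ∧ Φ ⁻¹' B = S := by
  have hdis : Disjoint (Φ '' S) (Φ '' Sᶜ) := by
    rw [Set.disjoint_left]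
    rintro _ ⟨g, hg, rfl⟩ ⟨g', hg', h⟩
    exact hg' (hsat g g' h.symm hg)
  obtain ⟨B, hSB, hBS, hB⟩ := (hS.analyticSet_image hΦ).measurablySeparable
    (hS.compl.analyticSet_image hΦ) hdis
  refine ⟨B, hB, Set.Subset.antisymm (fun g hg => ?_) fun g hg => hSB ⟨g, hg, rfl⟩⟩
  by_contra hgS
  exact Set.disjoint_left.1 hBS ⟨g, hgS, rfl⟩ hg

/-- An integrable function which is orthogonal to the composition with `φ` of a separating star
algebra of bounded continuous functions, and whose real part is positive on a set measurable with
respect to `φ`, has real part at most zero. -/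
theorem re_nonpos_of_integral_mul_comp_eq_zero {X E : Type*} [MeasurableSpace X] {α : Measure X}
    [TopologicalSpace E] [PolishSpace E] [MeasurableSpace E] [BorelSpace E] {φ : X → E}
    (hφ : Measurable φ) {A : StarSubalgebra ℂ (E →ᵇ ℂ)}
    (hA : (A.map (BoundedContinuousFunction.toContinuousMapStarₐ ℂ)).SeparatesPoints)
    {F : X → ℂ} (hFm : Measurable F) (hF : Integrable F α)
    (h0 : ∀ f ∈ A, ∫ x, F x * f (φ x) ∂α = 0) {B : Set E} (hB : MeasurableSet B)
    (hBF : φ ⁻¹' B = {x | 0 < (F x).re}) : ∀ᵐ x ∂α, (F x).re ≤ 0 := by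
  have hre : Measurable fun x => (F x).re := Complex.measurable_re.comp hFm
  have hbdd : ∀ (k : X → ℂ), Integrable k α → ∀ f : E →ᵇ ℂ,
      Integrable (fun x => k x * f (φ x)) α := by
    intro k hk f
    exact hk.mul_bdd (c := ‖f‖) (f.continuous.measurable.comp hφ).aestronglyMeasurable
      (Filter.Eventually.of_forall fun x => f.norm_coe_le_norm _)
  have hconj : ∀ f ∈ A, ∫ x, conj (F x) * f (φ x) ∂α = 0 := by
    intro f hf
    have h1 := congrArg conj (h0 (star f) (star_mem hf))
    rw [← integral_conj, map_zero] at h1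
    rw [← h1]
    congr 1
    funext x
    rw [map_mul]
    congr 1
    exact (Complex.conj_conj _).symm
  have hrez : ∀ f ∈ A, ∫ x, ((F x).re : ℂ) * f (φ x) ∂α = 0 := by
    intro f hf
    have hFc : Integrable (fun x => conj (F x)) α :=
      memLp_one_iff_integrable.1 (memLp_one_iff_integrable.2 hF).star
    have h1 : (fun x => ((F x).re : ℂ) * f (φ x)) =
        fun x => (1 / 2 : ℂ) * (F x * f (φ x) + conj (F x) * f (φ x)) := by
      funext x
      rw [← add_mul, Complex.add_conj]
      push_cast
      ring
    rw [h1, integral_const_mul, integral_add (hbdd _ hF f) (hbdd _ hFc f), h0 f hf, hconj f hf]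
    simp
  -- For a = 1 and a = -1 these are the positive and negative parts of Re F, as finite measures.
  -- Their images under φ agree on the separating algebra, hence coincide. Evaluated on B, where the
  -- negative part has no mass, they show that the positive part vanishes.
  let ν : ℝ → Measure X := fun a => α.withDensity fun x => ENNReal.ofReal (a * (F x).re)
  have hνfin : ∀ a, IsFiniteMeasure (ν a) := fun a =>
    isFiniteMeasure_withDensity_ofReal (hF.re.const_mul a).2
  have hν : ∀ a (f : E →ᵇ ℂ), ∫ y, f y ∂((ν a).map φ) =
      ∫ x, ((max (a * (F x).re) 0 : ℝ) : ℂ) * f (φ x) ∂α := by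
    intro a f
    rw [integral_map hφ.aemeasurable f.continuous.measurable.aestronglyMeasurable,
      integral_withDensity_eq_integral_toReal_smul (hre.const_mul a).ennreal_ofReal
        (Filter.Eventually.of_forall fun _ => ENNReal.ofReal_lt_top)]
    rfl
  have hmax : ∀ a : ℝ, Integrable (fun x => ((max (a * (F x).re) 0 : ℝ) : ℂ)) α := fun a =>
    (hF.re.const_mul a).pos_part.ofReal
  have hmeas : (ν 1).map φ = (ν (-1)).map φ := by
    refine ext_of_forall_mem_subalgebra_integral_eq_of_polish hA fun f hf => ?_
    rw [hν, hν, ← sub_eq_zero, ← integral_sub (hbdd _ (hmax 1) f) (hbdd _ (hmax (-1)) f),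
      ← hrez f hf]
    refine integral_congr_ae (Filter.Eventually.of_forall fun x => ?_)
    change _ * _ - _ * _ = _ * _
    rw [← sub_mul, ← Complex.ofReal_sub]
    congr 2
    rcases le_total 0 (F x).re with h | h
    · rw [max_eq_left (by linarith), max_eq_right (by linarith)]; ring
    · rw [max_eq_right (by linarith), max_eq_left (by linarith)]; ring
  have hS : MeasurableSet {x | 0 < (F x).re} := hBF ▸ hφ hB
  have h1 := congrArg (fun m => m B) hmeas
  simp only [Measure.map_apply hφ hB, hBF, ν, withDensity_apply _ hS] at h1
  have h2 : ∫⁻ x in {x | 0 < (F x).re}, ENNReal.ofReal (-1 * (F x).re) ∂α = 0 := by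
    rw [setLIntegral_congr_fun hS (g := fun _ => 0)]
    · simp
    · intro x hx
      have hx' : 0 < (F x).re := hx
      exact ENNReal.ofReal_of_nonpos (by linarith)
  rw [h2, lintegral_eq_zero_iff (hre.const_mul 1).ennreal_ofReal,
    Filter.EventuallyEq, ae_restrict_iff' hS] at h1
  filter_upwards [h1] with x hx
  by_contra! hlt
  have h3 := hx hlt
  simp only [Pi.zero_apply, one_mul, ENNReal.ofReal_eq_zero] at h3
  exact absurd hlt (not_lt.2 h3)

end Separation

/-! ### Injectivity of the Fourier transform along the bicharacter -/

section Fourier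

theorem polishSpace_of_locallyCompact (G : Type*) [Group G] [TopologicalSpace G]
    [IsTopologicalGroup G] [T2Space G] [LocallyCompactSpace G] [SecondCountableTopology G] :
    PolishSpace G := by
  let := IsTopologicalGroup.rightUniformSpace G
  have : IsRightUniformGroup G := { uniformity_eq := rfl }
  have : CompleteSpace G := IsRightUniformGroup.completeSpace_of_weaklyLocallyCompactSpace
  have : (uniformity G).IsCountablyGenerated := by
    rw [uniformity_eq_comap_mul_inv_nhds_one]; infer_instance
  exact ⟨⟩

/-- The star algebra of bounded continuous functions whose composition with `Φ` is in the algebra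
generated by a star closed set of functions. -/
def boundedContinuousComap {G E : Type*} [TopologicalSpace E] (Φ : G → E) (M : Set (G → ℂ))
    (hM : ∀ m ∈ M, star m ∈ M) : StarSubalgebra ℂ (E →ᵇ ℂ) where
  carrier := {f | (f ∘ Φ : G → ℂ) ∈ Algebra.adjoin ℂ M}
  mul_mem' := fun ha hb => (Algebra.adjoin ℂ M).mul_mem ha hb
  add_mem' := fun ha hb => (Algebra.adjoin ℂ M).add_mem ha hb
  algebraMap_mem' := fun r => (Algebra.adjoin ℂ M).algebraMap_mem r
  star_mem' := by
    intro f hf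
    have h : ∀ v ∈ Algebra.adjoin ℂ M, star v ∈ Algebra.adjoin ℂ M := by
      intro v hv
      induction hv using Algebra.adjoin_induction with
      | mem x hx => exact Algebra.subset_adjoin (hM x hx)
      | algebraMap r =>
        have : star (algebraMap ℂ (G → ℂ) r) = algebraMap ℂ (G → ℂ) (star r) := rfl
        rw [this]
        exact (Algebra.adjoin ℂ M).algebraMap_mem _
      | add x y _ _ hx hy => rw [star_add]; exact add_mem hx hy
      | mul x y _ _ hx hy => rw [star_mul]; exact mul_mem hy hx
    exact h _ hf

theorem mem_boundedContinuousComap {G E : Type*} [TopologicalSpace E] {Φ : G → E}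
    {M : Set (G → ℂ)} {hM : ∀ m ∈ M, star m ∈ M} {f : E →ᵇ ℂ} :
    f ∈ boundedContinuousComap Φ M hM ↔ (f ∘ Φ : G → ℂ) ∈ Algebra.adjoin ℂ M :=
  Iff.rfl

variable {G : Type*} [Group G] {H : Type*} [NormedAddCommGroup H] [InnerProductSpace ℂ H]
  [CompleteSpace H] {π : G →* unitary (H →L[ℂ] H)} {c : commutator G →* Circle}

/-- A continuous function with vanishing Fourier coefficients with respect to the characters
`commutatorPairing c g` vanishes, if it is constant where these characters are. -/
theorem comp_section_ae_eq_zero [TopologicalSpace G] [IsTopologicalGroup G] [T2Space G]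
    [LocallyCompactSpace G] [SecondCountableTopology G] [MeasurableSpace G] [BorelSpace G]
    [Nontrivial H] {X : Type*} [MeasurableSpace X] {α : Measure X} {s : X → G} (hs : Measurable s)
    (hc : ∀ (k : commutator G) (v : H), (π k : H →L[ℂ] H) v = (c k : ℂ) • v)
    (hcont : ∀ v : H, Continuous fun g : G => (π g : H →L[ℂ] H) v)
    {F : G → ℂ} (hFc : Continuous F)
    (hsat : ∀ h h', (∀ g, commutatorPairing c g h = commutatorPairing c g h') → F h' = F h)
    (hF : Integrable (fun x => F (s x)) α)
    (h0 : ∀ g, ∫ x, F (s x) * commutatorPairing c g (s x) ∂α = 0) :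
    (fun x => F (s x)) =ᵐ[α] fun _ => 0 := by
  have := polishSpace_of_locallyCompact G
  have : SecondCountableTopology Circle :=
    inferInstanceAs (SecondCountableTopology (Submonoid.unitSphere ℂ))
  borelize (ℕ → Circle)
  have hγ := continuous_commutatorPairing hc hcont
  have hγl : ∀ g, Continuous fun h => commutatorPairing c g h := fun g =>
    hγ.comp (Continuous.prodMk continuous_const continuous_id)
  have hγr : ∀ h, Continuous fun g => commutatorPairing c g h := fun h =>
    hγ.comp (Continuous.prodMk continuous_id continuous_const)
  -- A dense sequence of characters suffices, by continuity of the pairing in g, and it keeps the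
  -- target 𝕋^ℕ Polish.
  let Φ : G → ℕ → Circle := fun h n => commutatorPairing c (TopologicalSpace.denseSeq G n) h
  have hΦc : Continuous Φ := continuous_pi fun n => hγl _
  have hΦ : ∀ h h', Φ h = Φ h' → F h' = F h := by
    intro h h' heq
    refine hsat h h' fun g => ?_
    exact congrFun (Continuous.ext_on (TopologicalSpace.denseRange_denseSeq G) (hγr h) (hγr h')
      (by rintro _ ⟨n, rfl⟩; exact congrFun heq n)) g
  -- The characters form a multiplicative monoid, so the algebra they generate is their linear span,
  -- and testing against it reduces to the Fourier coefficients.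
  let Γ : G →* (G → ℂ) :=
    { toFun := fun g h => commutatorPairing c g h
      map_one' := funext fun h => by rw [commutatorPairing_one_left hc]; rfl
      map_mul' := fun g g' => funext fun h => by rw [commutatorPairing_mul_left hc]; rfl }
  have hstar : ∀ g, star (Γ g) = Γ g⁻¹ := by
    intro g
    funext h
    have h1 := commutatorPairing_mul_left hc g g⁻¹ h
    rw [mul_inv_cancel, commutatorPairing_one_left hc] at h1
    change conj (commutatorPairing c g h : ℂ) = (commutatorPairing c g⁻¹ h : ℂ)
    rw [eq_inv_of_mul_eq_one_right h1.symm, Circle.coe_inv_eq_conj]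
  let A := boundedContinuousComap Φ (MonoidHom.mrange Γ : Set (G → ℂ)) (by
    rintro _ ⟨g, rfl⟩
    exact ⟨g⁻¹, (hstar g).symm⟩)
  have hsep : (A.map (BoundedContinuousFunction.toContinuousMapStarₐ ℂ)).SeparatesPoints := by
    intro x y hxy
    obtain ⟨n, hn⟩ := Function.ne_iff.1 hxy
    let f : (ℕ → Circle) →ᵇ ℂ := BoundedContinuousFunction.mkOfCompact
      ⟨fun x => (x n : ℂ), by fun_prop⟩
    have hf : f ∈ A := mem_boundedContinuousComap.2 <| Algebra.subset_adjoin ⟨TopologicalSpace.denseSeq G n, rfl⟩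
    exact ⟨_, ⟨_, ⟨f, hf, rfl⟩, rfl⟩, fun h => hn (Circle.ext h)⟩
  have hint : ∀ f ∈ A, ∫ x, F (s x) * f (Φ (s x)) ∂α = 0 := by
    intro f hf
    have hv : ∀ v ∈ Submodule.span ℂ (MonoidHom.mrange Γ : Set (G → ℂ)),
        Integrable (fun x => F (s x) * v (s x)) α ∧ ∫ x, F (s x) * v (s x) ∂α = 0 := by
      intro v hv
      induction hv using Submodule.span_induction with
      | mem v hv =>
        obtain ⟨g, rfl⟩ := hv
        refine ⟨hF.mul_bdd (c := 1) ?_ (Filter.Eventually.of_forall fun x => ?_), h0 g⟩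
        · exact ((continuous_subtype_val.comp (hγl g)).measurable.comp hs).aestronglyMeasurable
        · exact (Circle.norm_coe _).le
      | zero => simp
      | add v w _ _ hv hw =>
        simp only [Pi.add_apply, mul_add]
        refine ⟨hv.1.add hw.1, ?_⟩
        rw [integral_add hv.1 hw.1, hv.2, hw.2, add_zero]
      | smul a v _ hv =>
        simp only [Pi.smul_apply, smul_eq_mul, mul_left_comm _ a]
        exact ⟨hv.1.const_mul a, by rw [integral_const_mul, hv.2, mul_zero]⟩
    refine (hv (f ∘ Φ) ?_).2
    have h1 : (f ∘ Φ : G → ℂ) ∈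
        Subalgebra.toSubmodule (Algebra.adjoin ℂ (MonoidHom.mrange Γ : Set (G → ℂ))) :=
      mem_boundedContinuousComap.1 hf
    rwa [Algebra.adjoin_eq_span, Submonoid.closure_eq] at h1
  -- The values 1, -1, i and -i of a give both inequalities for the real and the imaginary part of
  -- F.
  have hre : ∀ a : ℂ, ∀ᵐ x ∂α, (a * F (s x)).re ≤ 0 := by
    intro a
    have hcont' : Continuous fun h => (a * F h).re :=
      Complex.continuous_re.comp (continuous_const.mul hFc)
    obtain ⟨B, hB, hBS⟩ := exists_measurableSet_preimage_eq hΦc.measurable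
      (S := {h | 0 < (a * F h).re}) (measurableSet_lt measurable_const hcont'.measurable)
      (fun g g' hgg hg => by
        change 0 < (a * F g').re
        rw [hΦ g g' hgg]
        exact hg)
    refine re_nonpos_of_integral_mul_comp_eq_zero (φ := fun x => Φ (s x))
      (F := fun x => a * F (s x)) (hΦc.measurable.comp hs) hsep
      ((continuous_const.mul hFc).measurable.comp hs) (hF.const_mul a) (fun f hf => ?_) hB ?_
    · simp only [mul_assoc]
      rw [integral_const_mul, hint f hf, mul_zero]
    · exact congrArg (fun S => s ⁻¹' S) hBS
  filter_upwards [hre 1, hre (-1), hre Complex.I, hre (-Complex.I)] with x h1 h2 h3 h4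
  simp at h1 h2 h3 h4
  exact Complex.ext (le_antisymm h1 h2) (le_antisymm h4 h3)

end Fourier

/-! ### Recovering the state -/

section Main

variable {G : Type*} [Group G] [TopologicalSpace G] [IsTopologicalGroup G] [T2Space G]
  [LocallyCompactSpace G] [SecondCountableTopology G] [MeasurableSpace G] [BorelSpace G]
  {α : Measure (G ⧸ Subgroup.center G)} [α.IsHaarMeasure]
  {s : G ⧸ Subgroup.center G → G}
  {H : Type*} [NormedAddCommGroup H] [InnerProductSpace ℂ H] [CompleteSpace H]
  {π : G →* unitary (H →L[ℂ] H)} {d : ℝ} {ι κ κ' : Type*} [Countable ι] [Countable κ]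
  [Countable κ'] {T : H →L[ℂ] H} {t : ι → H} {w : κ → H} {w' : κ' → H}

/-- The densities determine the functions `g ↦ tr[W π(g)]`. -/
theorem HasOrthogonality.coeffTrace_eq_of_conjTrace_eq (h : HasOrthogonality π s α d)
    (μ : Measure G) [μ.IsHaarMeasure] (hs : Measurable s)
    (hsection : ∀ x : G ⧸ Subgroup.center G, (QuotientGroup.mk (s x) : G ⧸ Subgroup.center G) = x)
    (hcont : ∀ v : H, Continuous fun g : G => (π g : H →L[ℂ] H) v) (hirr : IsIrreducible π)
    {c : commutator G →* Circle}
    (hc : ∀ (k : commutator G) (v : H), (π k : H →L[ℂ] H) v = (c k : ℂ) • v)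
    (hT : IsRankOneSum T t) (htr : ∀ᵐ g ∂μ, coeffTrace π t g ≠ 0)
    (hw : Summable fun i => ‖w i‖ ^ 2) (hw' : Summable fun i => ‖w' i‖ ^ 2)
    (heq : conjTrace π T w = conjTrace π T w') : coeffTrace π w = coeffTrace π w' := by
  have := hirr.1
  have := borelSpace_quotient_center G
  have hwc := continuous_coeffTrace hcont hw
  have hwc' := continuous_coeffTrace hcont hw'
  have htc := continuous_coeffTrace hcont hT.summable
  let F : G → ℂ := fun g => conj (coeffTrace π w g) * coeffTrace π t g -
    conj (coeffTrace π w' g) * coeffTrace π t g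
  have hFc : Continuous F := ((Complex.continuous_conj.comp hwc).mul htc).sub
    ((Complex.continuous_conj.comp hwc').mul htc)
  have hi := (h.integral_coeffTrace hT.summable hw).1
  have hi' := (h.integral_coeffTrace hT.summable hw').1
  have hsat : ∀ h h', (∀ g, commutatorPairing c g h = commutatorPairing c g h') → F h' = F h :=
    fun h h' hh => by
      simp only [F]
      rw [conj_coeffTrace_eq_of_commutatorPairing_eq hc hirr t w hh,
        conj_coeffTrace_eq_of_commutatorPairing_eq hc hirr t w' hh]
  have hγl : ∀ g, Measurable fun x => (commutatorPairing c g (s x) : ℂ) := fun g =>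
    (continuous_subtype_val.comp ((continuous_commutatorPairing hc hcont).comp
      (Continuous.prodMk continuous_const continuous_id))).measurable.comp hs
  have h0 : ∀ g, ∫ x, F (s x) * commutatorPairing c g (s x) ∂α = 0 := by
    intro g
    -- Taken at g⁻¹, so that the conjugation becomes g x g⁻¹ and produces the character of g.
    have e1 := h.integral_coeffTrace_conj hT hw g⁻¹
    have e2 := h.integral_coeffTrace_conj hT hw' g⁻¹
    rw [← heq, ← e1] at e2
    simp only [inv_inv, coeffTrace_conj hc] at e2
    have hb : ∀ k : G ⧸ Subgroup.center G → ℂ, Integrable k α →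
        Integrable (fun x => k x * commutatorPairing c g (s x)) α := fun k hk =>
      hk.mul_bdd (c := 1) (hγl g).aestronglyMeasurable
        (Filter.Eventually.of_forall fun x => (Circle.norm_coe _).le)
    simp only [F, sub_mul]
    rw [integral_sub (hb _ hi) (hb _ hi'), sub_eq_zero]
    convert e2.symm using 3 <;> ring
  have hae := comp_section_ae_eq_zero hs hc hcont hFc hsat (hi.sub hi') h0
  have hFz : ∀ h, ∀ z ∈ Subgroup.center G, F (h * z) = F h := by
    intro h z hz
    obtain ⟨a, ha, hav⟩ := hirr.exists_smul_of_mem_center hz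
    simp only [F]
    rw [conj_coeffTrace_mul_of_smul ha hav, conj_coeffTrace_mul_of_smul ha hav]
  have hF0 : ∀ g, F g = 0 := by
    intro g
    have h1 := (Continuous.ae_eq_iff_eq α (continuous_comp_section hsection hFc hFz)
      continuous_const).1 hae
    rw [← comp_section_mk hsection hFz g]
    exact congrFun h1 _
  refine (Continuous.ae_eq_iff_eq μ hwc hwc').1 ?_
  filter_upwards [htr] with g hg
  have h1 := hF0 g
  simp only [F, ← sub_mul, ← map_sub] at h1
  have h2 := (mul_eq_zero.1 h1).resolve_right hg
  rwa [map_eq_zero, sub_eq_zero] at h2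

/-- The function `g ↦ tr[W π(g)]` determines `W`. -/
theorem HasOrthogonality.eq_of_coeffTrace_eq {G : Type*} [Group G]
    [MeasurableSpace (G ⧸ Subgroup.center G)] {α : Measure (G ⧸ Subgroup.center G)}
    {s : G ⧸ Subgroup.center G → G} {π : G →* unitary (H →L[ℂ] H)}
    (h : HasOrthogonality π s α d) {W W' : H →L[ℂ] H}
    (hW : IsRankOneSum W w) (hW' : IsRankOneSum W' w') (heq : coeffTrace π w = coeffTrace π w') :
    W = W' := by
  -- A one-term family stands for the rank one operator of u; testing against it at g = 1 gives the
  -- quadratic form of W at u.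
  have hu : ∀ u : H, Summable fun _ : Unit => ‖u‖ ^ 2 := fun u => (hasSum_fintype _).summable
  have key : ∀ u, (d : ℂ) * inner ℂ u (W u) = d * inner ℂ u (W' u) := by
    intro u
    have h1 := h.integral_coeffTrace_conj hW (hu u) 1
    have h2 := h.integral_coeffTrace_conj hW' (hu u) 1
    rw [heq, h2] at h1
    simpa [conjTrace, rep_one_apply] using h1.symm
  have hd : (d : ℂ) ≠ 0 := Complex.ofReal_ne_zero.2 h.pos.ne'
  have h3 : (W : H →ₗ[ℂ] H) = W' := by
    refine (ext_inner_map _ _).1 fun u => ?_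
    rw [← inner_conj_symm, ← inner_conj_symm ((W' : H →ₗ[ℂ] H) u)]
    exact congrArg conj (mul_left_cancel₀ hd (key u))
  exact ContinuousLinearMap.coe_injective h3

end Main

end SquareIntegrable

theorem mainTheorem3
    {G : Type*} [Group G] [TopologicalSpace G] [IsTopologicalGroup G] [T2Space G]
    [LocallyCompactSpace G] [SecondCountableTopology G] [MeasurableSpace G] [BorelSpace G]
    -- `G` is unimodular, with Haar measure `μ`
    (μ : Measure G) [μ.IsHaarMeasure] [μ.IsMulRightInvariant]
    -- a Haar measure on `G ⧸ Z` and a Borel section of `G → G ⧸ Z`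
    (α : Measure (G ⧸ Subgroup.center G)) [α.IsHaarMeasure]
    (s : G ⧸ Subgroup.center G → G) (hs : Measurable s)
    (hsection : ∀ x : G ⧸ Subgroup.center G, (QuotientGroup.mk (s x) : G ⧸ Subgroup.center G) = x)
    {H : Type*} [NormedAddCommGroup H] [InnerProductSpace ℂ H] [CompleteSpace H]
    [TopologicalSpace.SeparableSpace H]
    -- a continuous irreducible unitary representation, square integrable modulo the centre
    (π : G →* unitary (H →L[ℂ] H))
    (hcont : ∀ v : H, Continuous fun g : G => (π g : H →L[ℂ] H) v)
    (hirr : SquareIntegrable.IsIrreducible π)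
    (hsq : SquareIntegrable.IsSquareIntegrableModCenter π s α)
    -- a subspace on which the commutator subgroup acts by a character
    (K : Submodule ℂ H) (c : commutator G →* Circle)
    (hc : ∀ g : commutator G, ∀ v ∈ K, (π (g : G) : H →L[ℂ] H) v = (c g : ℂ) • v)
    (T : H →L[ℂ] H) (hT : SquareIntegrable.IsState T)
    (hTK : ∀ v : H, T v ∈ K)
    (htr : ∀ᵐ g ∂μ, SquareIntegrable.trace (T ∘L (π g : H →L[ℂ] H)) ≠ 0) :
    (∀ E : Set (G ⧸ Subgroup.center G), MeasurableSet E →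
      SquareIntegrable.IsWeakIntegral π s α T E (SquareIntegrable.covariantPOM π s α T E)) ∧
    SquareIntegrable.InformationallyComplete (SquareIntegrable.covariantPOM π s α T) := by
  have := SquareIntegrable.borelSpace_quotient_center G
  have := SquareIntegrable.basisSet_countable (H := H)
  obtain ⟨d, hd, hortho⟩ := hirr.exists_integral_inner_mul_conj_inner hsection hcont hsq
  have h : SquareIntegrable.HasOrthogonality π s α d := ⟨hsq, hd, hortho⟩
  obtain ⟨t, ht, htT⟩ := hT.exists_isRankOneSum
  have hweak : ∀ E, SquareIntegrable.IsWeakIntegral π s α T E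
      (SquareIntegrable.covariantPOM π s α T E) := fun E =>
    SquareIntegrable.isWeakIntegral_covariantPOM (h.exists_isWeakIntegral ht E)
  have hct : ∀ i, ∀ k : commutator G, (π k : H →L[ℂ] H) (t i) = (c k : ℂ) • t i := by
    -- The operator π(k) - c(k) kills the range of T, hence every t i.
    intro i k
    have h1 := htT ((π k : H →L[ℂ] H) - (c k : ℂ) • (1 : H →L[ℂ] H)) (by
      ext v
      have h2 := hc k (T v) (hTK v)
      simp [h2]) i
    simpa [sub_eq_zero] using h1
  have htr' : ∀ᵐ g ∂μ, SquareIntegrable.coeffTrace π t g ≠ 0 := by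
    filter_upwards [htr] with g hg
    rwa [ht.trace_comp] at hg
  have hcs := hirr.commutator_apply μ hct htr'
  refine ⟨fun E _ => hweak E, fun W₁ W₂ hW₁ hW₂ heq => ?_⟩
  obtain ⟨w₁, hw₁, -⟩ := hW₁.exists_isRankOneSum
  obtain ⟨w₂, hw₂, -⟩ := hW₂.exists_isRankOneSum
  obtain ⟨hi₁, htr₁⟩ := h.trace_comp_weakIntegral ht hw₁
  obtain ⟨hi₂, htr₂⟩ := h.trace_comp_weakIntegral ht hw₂
  have hae := hi₁.ae_eq_of_forall_setIntegral_eq _ _ hi₂ fun E hE _ => by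
    rw [← htr₁ E _ (hweak E), ← htr₂ E _ (hweak E), heq E hE]
  have hcenter : ∀ w : SquareIntegrable.basisSet H → H, ∀ g, ∀ z ∈ Subgroup.center G,
      SquareIntegrable.conjTrace π T w (g * z) = SquareIntegrable.conjTrace π T w g :=
    fun w g z hz => hirr.conjTrace_mul_center T g hz
  have hfun := (Continuous.ae_eq_iff_eq α
    (SquareIntegrable.continuous_comp_section hsection
      (SquareIntegrable.continuous_conjTrace hcont T hw₁.summable) (hcenter w₁))
    (SquareIntegrable.continuous_comp_section hsection
      (SquareIntegrable.continuous_conjTrace hcont T hw₂.summable) (hcenter w₂))).1 hae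
  have hconj : SquareIntegrable.conjTrace π T w₁ = SquareIntegrable.conjTrace π T w₂ := by
    funext g
    rw [← SquareIntegrable.comp_section_mk hsection (hcenter w₁) g,
      ← SquareIntegrable.comp_section_mk hsection (hcenter w₂) g]
    exact congrFun hfun _
  exact h.eq_of_coeffTrace_eq hw₁ hw₂ (h.coeffTrace_eq_of_conjTrace_eq μ hs hsection hcont hirr
    hcs ht htr' hw₁.summable hw₂.summable hconj)
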